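/- Let $n\ge 2$, let $\mathbb R^n_+=\{(\bar x,x_n)\in\mathbb R^{n-1}\times\mathbb R : x_n>0\}$, and identify $\partial\mathbb R^n_+$ with $\mathbb R^{n-1}$. Let $H^{1/2}(\mathbb R^{n-1})$ be the space of complex-valued $g\in L^2(\mathbb R^{n-1})$ with finite Gagliardo seminorm \[ |g|_{H^{1/2}(\mathbb R^{n-1})}^2=\int_{\mathbb R^{n-1}}\int_{\mathbb R^{n-1}}\frac{|g(x)-g(y)|^2}{|x-y|^n}\,dy\,dx . \] For $\sigma>0$ and $g\in H^{1/2}(\mathbb R^{n-1})$ define the weighted minimal extension norm \[ \|g\|_{H^{1/2}(\mathbb R^{n-1},\sigma,\mathbb R^n_+)}=\inf\Big\{\big(\|\nabla v\|_{L^2(\mathbb R^n_+)}^2+\sigma^2\|v\|_{L^2(\mathbb R^n_+)}^2\big)^{1/2} : v\in H^1(\mathbb R^n_+),\ v|_{\mathbb R^{n-1}}=g\Big\}, \] where $v|_{\mathbb R^{n-1}}$ is the Dirichlet trace. Let $\mathcal F$ be the Fourier transform on $L^2(\mathbb R^{n-1})$, normalized by $\mathcal Fg(\xi)=(2\pi)^{-(n-1)}\int_{\mathbb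 R^{n-1}}g(x)e^{-ix\cdot\xi}\,dx$ for $g \in L^1\cap L^2$. Then every $g\in H^{1/2}(\mathbb R^{n-1})$ and every $\sigma>0$ satisfy \[ \|g\|_{H^{1/2}(\mathbb R^{n-1},\sigma,\mathbb R^n_+)}^2=(2\pi)^{n-1}\int_{\mathbb R^{n-1}}(\sigma^2+|\xi|^2)^{1/2}\,|\mathcal Fg(\xi)|^2\,d\xi . \] Moreover, there are constants $c,C>0$ depending only on $n$ such that, for all $g\in H^{1/2}(\mathbb R^{n-1})$ and all $\sigma>0$, \[ c\,\big(|g|_{H^{1/2}(\mathbb R^{n-1})}^2+\sigma\|g\|_{L^2(\mathbb R^{n-1})}^2\big)\le\|g\|_{H^{1/2}(\mathbb R^{n-1},\sigma,\mathbb R^n_+)}^2\le C\,\big(|g|_{H^{1/2}(\mathbb R^{n-1})}^2+\sigma\|g\|_{L^2(\mathbb R^{n-1})}^2\big). \] -/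

import Mathlib

open MeasureTheory Filter Topology
open scoped ENNReal ContDiff FourierTransform

noncomputable section

namespace HalfSpace

/-- The boundary space `ℝ^d` (with `d = n - 1`), with its Euclidean norm and Lebesgue measure. -/
abbrev Bd (d : ℕ) : Type := EuclideanSpace ℝ (Fin d)

/-- The open half-space `{(x, t) ∈ ℝ^d × ℝ : t > 0}` in dimension `n = d + 1`. -/
def upper (d : ℕ) : Set (Bd d × ℝ) := {p | 0 < p.2}

/-- Lebesgue measure on the half-space. -/
def vol (d : ℕ) : Measure (Bd d × ℝ) := volume.restrict (upper d)

/-- The coordinate directions of `ℝ^d × ℝ`: `d` tangential ones and the normal one. -/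
def dir {d : ℕ} : Fin d ⊕ Unit → Bd d × ℝ
  | Sum.inl i => (EuclideanSpace.single i 1, 0)
  | Sum.inr _ => (0, 1)

/-- The classical partial derivative of `φ` in the `i`-th coordinate direction. -/
def pderiv {d : ℕ} (i : Fin d ⊕ Unit) (φ : Bd d × ℝ → ℂ) (p : Bd d × ℝ) : ℂ :=
  fderiv ℝ φ p (dir i)

/-- The complex Sobolev space `H¹` of the half-space: `L²` functions together with their
(almost everywhere unique) weak partial derivatives, which are also in `L²`. -/
structure H1 (d : ℕ) where
  /-- the function -/
  val : Lp ℂ 2 (vol d)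
  /-- its weak partial derivatives -/
  grad : Fin d ⊕ Unit → Lp ℂ 2 (vol d)
  /-- integration by parts against smooth functions with compact support in the half-space -/
  weak : ∀ (i : Fin d ⊕ Unit) (φ : Bd d × ℝ → ℂ), ContDiff ℝ ∞ φ → HasCompactSupport φ →
    tsupport φ ⊆ upper d →
    ∫ p, val p * pderiv i φ p ∂(vol d) = -∫ p, grad i p * φ p ∂(vol d)

/-- The weighted energy norm `(‖∇v‖² + σ² ‖v‖²)^{1/2}`. -/
def H1.wnorm {d : ℕ} (v : H1 d) (σ : ℝ) : ℝ :=
  Real.sqrt (∑ i, ‖v.grad i‖ ^ 2 + σ ^ 2 * ‖v.val‖ ^ 2)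

/-- `v.HasTrace g`: the Dirichlet trace of `v` on `ℝ^d × {0}` is `g`. The trace operator is the
continuous extension of the pointwise restriction of smooth functions, so its graph consists of
the limits of pairs `(φ, φ(·, 0))` with `φ` smooth up to the boundary. -/
def H1.HasTrace {d : ℕ} (v : H1 d) (g : Lp ℂ 2 (volume : Measure (Bd d))) : Prop :=
  ∃ φ : ℕ → Bd d × ℝ → ℂ,
    (∀ k, ContDiff ℝ ∞ (φ k) ∧ HasCompactSupport (φ k)) ∧
    Tendsto (fun k => eLpNorm (fun p => φ k p - v.val p) 2 (vol d)) atTop (𝓝 0) ∧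
    (∀ i, Tendsto (fun k => eLpNorm (fun p => pderiv i (φ k) p - v.grad i p) 2 (vol d))
      atTop (𝓝 0)) ∧
    Tendsto (fun k => eLpNorm (fun x => φ k (x, 0) - g x) 2 volume) atTop (𝓝 0)

/-- The minimal extension norm of `g`: the infimum of the weighted energy norms of all `H¹`
extensions of `g` to the half-space (`∞` if there are none). -/
def minExtNorm {d : ℕ} (σ : ℝ) (g : Lp ℂ 2 (volume : Measure (Bd d))) : ℝ≥0∞ :=
  ⨅ (v : H1 d) (_ : v.HasTrace g), ENNReal.ofReal (v.wnorm σ)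

/-- The squared Gagliardo seminorm of order `1/2` on `ℝ^d`; the exponent is `n = d + 1`. -/
def gagliardoSq {d : ℕ} (g : Lp ℂ 2 (volume : Measure (Bd d))) : ℝ≥0∞ :=
  ∫⁻ x : Bd d, ∫⁻ y : Bd d, ‖g x - g y‖ₑ ^ 2 / ‖x - y‖ₑ ^ (d + 1)

/-- `g ∈ H^{1/2}(ℝ^d)`: the `L²` function `g` has finite Gagliardo seminorm. -/
def MemHHalf {d : ℕ} (g : Lp ℂ 2 (volume : Measure (Bd d))) : Prop :=
  gagliardoSq g < ⊤

/-- The `L²` (Plancherel) Fourier transform in the normalization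
`(F g)(ξ) = (2π)^{-d} ∫ g(x) exp(-i x·ξ) dx`, obtained by rescaling Mathlib's transform `𝓕`,
which has the kernel `exp(-2πi x·ξ)`. -/
def fourierT {d : ℕ} (g : Lp ℂ 2 (volume : Measure (Bd d))) (ξ : Bd d) : ℂ :=
  (((2 * Real.pi) ^ d)⁻¹ : ℝ) * (𝓕 g : Lp ℂ 2 (volume : Measure (Bd d))) ((2 * Real.pi)⁻¹ • ξ)

end HalfSpace

end

/-! A Fourier transform in the tangential variables turns the weighted energy, by Plancherel on each
horizontal slice, into an integral over frequencies `η` of the one-dimensional energies `∫₀^∞ |F'|²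
+ λ²|F|²`, where `λ² = σ² + |2πη|²` is `lam σ η ^ 2`. For fixed boundary value `F 0`, such an energy
is at least `λ|F 0|²`, because `-λ (|F|²)' ≤ |F'|² + λ²|F|²`, and `F 0 · exp (-λt)` attains
equality. So the minimum should be `∫ λ |𝓕 g|²`, which is `spectralSq`.

Lower bound: the argument applies directly to compactly supported smooth functions
(`lintegral_lam_mul_le_energy`). Fatou carries it to every pair in the graph of the trace
(`spectralSq_le_wnorm_sq`).

Upper bound: the exponential extension with transform `h` at the boundary has energy `∫ λ|h|²`
(`energy_expExt`). Writing `h = λ^{-1/2} ψ` makes the extension an isometry from `L²` into the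
energy space. Approximating `λ^{1/2} 𝓕 g` by test functions therefore gives a Cauchy sequence in
`H¹`, whose limit is the minimizer (`exists_H1_wnorm_sq_eq`). Cutoffs supply the compact supports
that the definition of trace demands.

Norm equivalence: Plancherel for the differences `g(· + z) - g` makes the Gagliardo seminorm a
Fourier multiplier. Its symbol is rotation invariant and homogeneous of degree one, hence `κ|η|`
with `0 < κ < ∞` (`exists_gagliardoSq_eq`). What remains is the pointwise comparison of `λ` with
`κ|η| + σ`, which also shows that `spectralSq` is finite on `H^{1/2}`. -/

noncomputable section

namespace HalfSpace

/-! ### Smooth dependence of integrals on parameters. -/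

section ParametricIntegral

variable {G P : Type} [NormedAddCommGroup G] [NormedSpace ℝ G]
  [MeasurableSpace G] [BorelSpace G] [NormedAddCommGroup P] [NormedSpace ℝ P]
  {μ : Measure G} [IsLocallyFiniteMeasure μ]

/-- The integral is the value at `0` of the convolution of the constant `1` with `y ↦ Ψ p (-y)`, so
smoothness of convolutions with a parameter applies. -/
theorem contDiff_integral_param {Ψ : P → G → ℂ} {K : Set G} (hK : IsCompact K)
    (hΨ : ContDiff ℝ ∞ (fun q : P × G => Ψ q.1 q.2)) (hs : ∀ p, ∀ y ∉ K, Ψ p y = 0) :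
    ContDiff ℝ ∞ (fun p => ∫ y, Ψ p y ∂μ) := by
  have hK' : IsCompact (Neg.neg '' K) := hK.image continuous_neg
  have h := contDiffOn_convolution_right_with_param_comp (𝕜 := ℝ) (n := ⊤) (μ := μ)
    (ContinuousLinearMap.mul ℝ ℂ) (s := Set.univ) (v := fun _ : P => (0 : G)) contDiffOn_const
    (f := fun _ => (1 : ℂ)) (g := fun p y => Ψ p (-y)) (k := Neg.neg '' K) isOpen_univ hK'
    (fun p x _ hx => hs p _ fun hx' => hx ⟨-x, hx', by simp⟩)
    (continuous_const.locallyIntegrable)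
    (ContDiff.contDiffOn (hΨ.comp (contDiff_fst.prodMk contDiff_snd.neg)))
  rw [contDiffOn_univ] at h
  convert h using 2 with p
  simp [convolution_def]

/-- Domination comes from compactness: the derivative is bounded on the closed unit ball around `p`
times `K`, and vanishes for `y` outside `K`. -/
theorem hasFDerivAt_integral_param [FiniteDimensional ℝ P] {Ψ : P → G → ℂ} {K : Set G}
    (hK : IsCompact K) (hΨ : ContDiff ℝ ∞ (fun q : P × G => Ψ q.1 q.2))
    (hs : ∀ p, ∀ y ∉ K, Ψ p y = 0) (p : P) :
    Integrable (fun y => fderiv ℝ (fun p => Ψ p y) p) μ ∧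
    HasFDerivAt (fun p => ∫ y, Ψ p y ∂μ) (∫ y, fderiv ℝ (fun p => Ψ p y) p ∂μ) p := by
  have hc : Continuous (fun q : P × G => fderiv ℝ (fun p => Ψ p q.2) q.1) := by
    have h1 := hΨ.continuous_fderiv (by simp)
    have : (fun q : P × G => fderiv ℝ (fun p => Ψ p q.2) q.1) = fun q =>
        (fderiv ℝ (fun q : P × G => Ψ q.1 q.2) q).comp (ContinuousLinearMap.inl ℝ P G) := by
      ext1 q
      exact (((hΨ.differentiable (by simp)) q).hasFDerivAt.comp (f := fun p => (p, q.2)) q.1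
        (hasFDerivAt_prodMk_left q.1 q.2)).fderiv
    rw [this]
    fun_prop
  have hz : ∀ p, ∀ y ∉ K, fderiv ℝ (fun p => Ψ p y) p = 0 := by
    intro p y hy
    have : (fun p => Ψ p y) = fun _ => 0 := by ext p; exact hs p y hy
    rw [this]; simp
  have hcomp : IsCompact (Metric.closedBall p 1 ×ˢ K) :=
    (isCompact_closedBall p 1).prod hK
  obtain ⟨C, hC⟩ := hcomp.exists_bound_of_continuousOn hc.continuousOn
  have hci : Continuous (fun y => Ψ p y) := hΨ.continuous.comp (Continuous.prodMk_right p)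
  have hcd : Continuous (fun y => fderiv ℝ (fun p => Ψ p y) p) :=
    hc.comp (Continuous.prodMk_right p)
  refine ⟨hcd.integrable_of_hasCompactSupport (HasCompactSupport.intro hK (hz p)), ?_⟩
  refine hasFDerivAt_integral_of_dominated_of_fderiv_le (s := Metric.ball p 1)
    (bound := K.indicator fun _ => C)
    (F := Ψ) (F' := fun p y => fderiv ℝ (fun p => Ψ p y) p) (Metric.ball_mem_nhds p one_pos)
    (Eventually.of_forall fun q => ?_) ?_ hcd.aestronglyMeasurable
    (Eventually.of_forall fun y q hq => ?_) ?_ (Eventually.of_forall fun y q hq => ?_)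
  · exact (hΨ.continuous.comp (Continuous.prodMk_right q)).aestronglyMeasurable
  · exact hci.integrable_of_hasCompactSupport (HasCompactSupport.intro hK (hs p))
  · by_cases hy : y ∈ K
    · rw [Set.indicator_of_mem hy]
      exact hC (q, y) ⟨Metric.ball_subset_closedBall hq, hy⟩
    · rw [Set.indicator_of_notMem hy, hz q y hy, norm_zero]
  · rw [integrable_indicator_iff hK.measurableSet]
    exact integrableOn_const hK.measure_lt_top.ne
  · exact ((hΨ.comp (by fun_prop : ContDiff ℝ ∞ fun p => (p, y))).differentiable
      (by simp) q).hasFDerivAt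

end ParametricIntegral

/-! ### Plancherel for test functions and integration over the half-space. -/

section Plancherel

variable {d : ℕ}

theorem eLpNorm_two_sq {α E : Type*} [MeasurableSpace α] [NormedAddCommGroup E] {μ : Measure α}
    (f : α → E) : eLpNorm f 2 μ ^ 2 = ∫⁻ x, ‖f x‖ₑ ^ 2 ∂μ := by
  have h := eLpNorm_nnreal_pow_eq_lintegral (μ := μ) (f := f) (p := 2) two_ne_zero
  simpa using h

theorem lintegral_enorm_sq_lp {α E : Type*} [MeasurableSpace α] [NormedAddCommGroup E]
    {μ : Measure α} (f : Lp E 2 μ) : ∫⁻ x, ‖f x‖ₑ ^ 2 ∂μ = ENNReal.ofReal (‖f‖ ^ 2) := by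
  rw [← eLpNorm_two_sq, ← Lp.enorm_def, ← ofReal_norm, ENNReal.ofReal_pow (norm_nonneg _)]

theorem lintegral_enorm_sq_fourier_lp (g : Lp ℂ 2 (volume : Measure (Bd d))) :
    ∫⁻ η, ‖(𝓕 g : Lp ℂ 2 (volume : Measure (Bd d))) η‖ₑ ^ 2 = ∫⁻ x, ‖g x‖ₑ ^ 2 := by
  rw [lintegral_enorm_sq_lp, lintegral_enorm_sq_lp, Lp.norm_fourier_eq]

theorem lintegral_enorm_sq_congr {α E : Type*} [MeasurableSpace α] [NormedAddCommGroup E]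
    {μ : Measure α} {f g : α → E} (h : f =ᵐ[μ] g) :
    ∫⁻ x, ‖f x‖ₑ ^ 2 ∂μ = ∫⁻ x, ‖g x‖ₑ ^ 2 ∂μ :=
  lintegral_congr_ae (by filter_upwards [h] with x hx; rw [hx])

/-- Test functions are Schwartz functions, on which the `L²` transform and the integral transform
agree. -/
theorem fourier_toLp_ae_eq {f : Bd d → ℂ} (hf : ContDiff ℝ ∞ f) (hc : HasCompactSupport f)
    (hm : MemLp f 2 volume) :
    (𝓕 (hm.toLp f) : Lp ℂ 2 (volume : Measure (Bd d))) =ᵐ[volume] 𝓕 f := by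
  have h := SchwartzMap.toLp_fourier_eq (hc.toSchwartzMap hf)
  have e : (hc.toSchwartzMap hf).toLp 2 = hm.toLp f := rfl
  rw [← e, h]
  exact SchwartzMap.coeFn_toLp _ _ _

theorem lintegral_enorm_sq_fourier {f : Bd d → ℂ} (hf : ContDiff ℝ ∞ f)
    (hc : HasCompactSupport f) : ∫⁻ η, ‖𝓕 f η‖ₑ ^ 2 = ∫⁻ x, ‖f x‖ₑ ^ 2 := by
  have hm : MemLp f 2 volume := hf.continuous.memLp_of_hasCompactSupport hc
  have h := lintegral_enorm_sq_fourier_lp (hm.toLp f)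
  rw [lintegral_enorm_sq_congr (fourier_toLp_ae_eq hf hc hm),
    lintegral_enorm_sq_congr hm.coeFn_toLp] at h
  exact h

theorem lintegral_enorm_sq_fourierInv {f : Bd d → ℂ} (hf : ContDiff ℝ ∞ f)
    (hc : HasCompactSupport f) : ∫⁻ η, ‖𝓕⁻ f η‖ₑ ^ 2 = ∫⁻ x, ‖f x‖ₑ ^ 2 := by
  rw [← lintegral_enorm_sq_fourier hf hc, ← lintegral_neg_eq_self]
  simp [Real.fourierInv_eq_fourier_neg]

theorem vol_eq_prod : vol d = volume.prod (volume.restrict (Set.Ioi 0)) := by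
  have : upper d = Set.univ ×ˢ Set.Ioi (0 : ℝ) := by ext; simp [upper]
  rw [vol, this, Measure.volume_eq_prod, ← Measure.prod_restrict, Measure.restrict_univ]

theorem lintegral_vol {f : Bd d × ℝ → ℝ≥0∞} (hf : Measurable f) :
    ∫⁻ p, f p ∂(vol d) = ∫⁻ t in Set.Ioi (0 : ℝ), ∫⁻ x, f (x, t) := by
  rw [vol_eq_prod, lintegral_prod_symm _ hf.aemeasurable]

end Plancherel

end HalfSpace

/-! ### The tangential Fourier transform, the energy and the one-dimensional inequality. -/

namespace HalfSpace

variable {d : ℕ}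

/-- The inverse Fourier transform in the tangential variables. -/
def tangentialFourierInv (Φ : Bd d × ℝ → ℂ) (p : Bd d × ℝ) : ℂ :=
  𝓕⁻ (fun η => Φ (η, p.2)) p.1

theorem tangentialFourierInv_eq (Φ : Bd d × ℝ → ℂ) (p : Bd d × ℝ) :
    tangentialFourierInv Φ p =
      ∫ η, Complex.exp (((2 * Real.pi * inner ℝ η p.1 : ℝ) : ℂ) * Complex.I) * Φ (η, p.2) := by
  simp [tangentialFourierInv, Real.fourierInv_eq', smul_eq_mul]

section

variable {Φ : Bd d × ℝ → ℂ} {K : Set (Bd d)}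

theorem contDiff_tangential_kernel (hΦ : ContDiff ℝ ∞ Φ) :
    ContDiff ℝ ∞ (fun q : (Bd d × ℝ) × Bd d =>
      Complex.exp (((2 * Real.pi * inner ℝ q.2 q.1.1 : ℝ) : ℂ) * Complex.I) *
        Φ (q.2, q.1.2)) := by
  have h1 : ContDiff ℝ ∞ (fun q : (Bd d × ℝ) × Bd d =>
      ((2 * Real.pi * inner ℝ q.2 q.1.1 : ℝ) : ℂ)) :=
    Complex.ofRealCLM.contDiff.comp (contDiff_const.mul (contDiff_snd.inner ℝ contDiff_fst.fst))
  exact ((h1.mul contDiff_const).cexp).mul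
    (hΦ.comp (contDiff_snd.prodMk contDiff_fst.snd))

theorem contDiff_tangentialFourierInv (hK : IsCompact K) (hΦ : ContDiff ℝ ∞ Φ)
    (hs : ∀ t, ∀ η ∉ K, Φ (η, t) = 0) : ContDiff ℝ ∞ (tangentialFourierInv Φ) := by
  rw [funext (tangentialFourierInv_eq Φ)]
  exact contDiff_integral_param (Ψ := fun (p : Bd d × ℝ) η => Complex.exp
    (((2 * Real.pi * inner ℝ η p.1 : ℝ) : ℂ) * Complex.I) * Φ (η, p.2)) hK
    (contDiff_tangential_kernel hΦ)
    fun p y hy => by simp [hs _ y hy]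

theorem pderiv_tangentialFourierInv (hK : IsCompact K) (hΦ : ContDiff ℝ ∞ Φ)
    (hs : ∀ t, ∀ η ∉ K, Φ (η, t) = 0) (i : Fin d ⊕ Unit) (p : Bd d × ℝ) :
    pderiv i (tangentialFourierInv Φ) p =
      ∫ η, fderiv ℝ (fun p : Bd d × ℝ =>
        Complex.exp (((2 * Real.pi * inner ℝ η p.1 : ℝ) : ℂ) * Complex.I) * Φ (η, p.2)) p
          (dir i) := by
  have h := hasFDerivAt_integral_param (Ψ := fun (p : Bd d × ℝ) η => Complex.exp
    (((2 * Real.pi * inner ℝ η p.1 : ℝ) : ℂ) * Complex.I) * Φ (η, p.2)) (μ := volume) hK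
    (contDiff_tangential_kernel hΦ)
    (fun p y hy => by simp [hs _ y hy]) p
  rw [pderiv, funext (tangentialFourierInv_eq Φ), h.2.fderiv,
    ContinuousLinearMap.integral_apply h.1]

theorem hasFDerivAt_tangential_kernel (hΦ : ContDiff ℝ ∞ Φ) (η : Bd d) (p : Bd d × ℝ) :
    HasFDerivAt (fun p : Bd d × ℝ =>
        Complex.exp (((2 * Real.pi * inner ℝ η p.1 : ℝ) : ℂ) * Complex.I) * Φ (η, p.2))
      (Complex.exp (((2 * Real.pi * inner ℝ η p.1 : ℝ) : ℂ) * Complex.I) •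
          ((fderiv ℝ Φ (η, p.2)).comp
            ((ContinuousLinearMap.inr ℝ (Bd d) ℝ).comp (ContinuousLinearMap.snd ℝ (Bd d) ℝ))) +
        Φ (η, p.2) • (Complex.exp (((2 * Real.pi * inner ℝ η p.1 : ℝ) : ℂ) * Complex.I) •
          (Complex.I • Complex.ofRealCLM.comp ((2 * Real.pi) •
            (innerSL ℝ η).comp (ContinuousLinearMap.fst ℝ (Bd d) ℝ))))) p := by
  have h1 : HasFDerivAt (fun p : Bd d × ℝ => Φ (η, p.2)) _ p :=
    ((hΦ.differentiable (by simp)) (η, p.2)).hasFDerivAt.comp p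
      ((hasFDerivAt_prodMk_right η p.2).comp p hasFDerivAt_snd)
  have h2 : HasFDerivAt (fun p : Bd d × ℝ => ((2 * Real.pi * inner ℝ η p.1 : ℝ) : ℂ))
      (Complex.ofRealCLM.comp ((2 * Real.pi) •
            (innerSL ℝ η).comp (ContinuousLinearMap.fst ℝ (Bd d) ℝ))) p :=
    (Complex.ofRealCLM.comp ((2 * Real.pi) •
            (innerSL ℝ η).comp (ContinuousLinearMap.fst ℝ (Bd d) ℝ))).hasFDerivAt
  exact ((h2.mul_const Complex.I).cexp).mul h1

theorem pderiv_inr_tangentialFourierInv (hK : IsCompact K) (hΦ : ContDiff ℝ ∞ Φ)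
    (hs : ∀ t, ∀ η ∉ K, Φ (η, t) = 0) (p : Bd d × ℝ) :
    pderiv (Sum.inr ()) (tangentialFourierInv Φ) p =
      tangentialFourierInv (pderiv (Sum.inr ()) Φ) p := by
  rw [pderiv_tangentialFourierInv hK hΦ hs, tangentialFourierInv_eq]
  congr 1 with η
  rw [(hasFDerivAt_tangential_kernel hΦ η p).fderiv]
  simp [dir, pderiv]

theorem pderiv_inl_tangentialFourierInv (hK : IsCompact K) (hΦ : ContDiff ℝ ∞ Φ)
    (hs : ∀ t, ∀ η ∉ K, Φ (η, t) = 0) (i : Fin d) (p : Bd d × ℝ) :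
    pderiv (Sum.inl i) (tangentialFourierInv Φ) p =
      tangentialFourierInv (fun q => ((2 * Real.pi * q.1 i : ℝ) : ℂ) * Complex.I * Φ q) p := by
  rw [pderiv_tangentialFourierInv hK hΦ hs, tangentialFourierInv_eq]
  congr 1 with η
  rw [(hasFDerivAt_tangential_kernel hΦ η p).fderiv]
  simp [dir, EuclideanSpace.inner_single_right, Prod.mk_zero_zero]
  ring

end

theorem contDiff_pderiv {φ : Bd d × ℝ → ℂ} (hφ : ContDiff ℝ ∞ φ) (i : Fin d ⊕ Unit) :
    ContDiff ℝ ∞ (pderiv i φ) :=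
  (hφ.fderiv_right (m := ∞) (by simp)).clm_apply contDiff_const

theorem hasCompactSupport_pderiv {φ : Bd d × ℝ → ℂ} (hφ : HasCompactSupport φ)
    (i : Fin d ⊕ Unit) : HasCompactSupport (pderiv i φ) :=
  hφ.fderiv_apply ℝ (dir i)

theorem hasDerivAt_slice {φ : Bd d × ℝ → ℂ} (hφ : ContDiff ℝ ∞ φ) (x : Bd d) (t : ℝ) :
    HasDerivAt (fun t => φ (x, t)) (pderiv (Sum.inr ()) φ (x, t)) t := by
  have h := ((hφ.differentiable (by simp)) (x, t)).hasFDerivAt.comp t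
    (hasFDerivAt_prodMk_right x t)
  have := h.hasDerivAt
  simp only [ContinuousLinearMap.comp_apply, ContinuousLinearMap.inr_apply] at this
  exact this

/-- The frequency weight `(σ² + |2πη|²)^{1/2}`. -/
def lam (σ : ℝ) (η : Bd d) : ℝ := Real.sqrt (σ ^ 2 + (2 * Real.pi * ‖η‖) ^ 2)

theorem lam_nonneg (σ : ℝ) (η : Bd d) : 0 ≤ lam σ η := Real.sqrt_nonneg _

theorem lam_sq (σ : ℝ) (η : Bd d) : lam σ η ^ 2 = σ ^ 2 + (2 * Real.pi * ‖η‖) ^ 2 :=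
  Real.sq_sqrt (by positivity)

theorem le_lam {σ : ℝ} (η : Bd d) : σ ≤ lam σ η :=
  Real.le_sqrt_of_sq_le (by nlinarith [sq_nonneg (2 * Real.pi * ‖η‖)])

theorem lam_pos {σ : ℝ} (hσ : 0 < σ) (η : Bd d) : 0 < lam σ η := hσ.trans_le (le_lam η)

theorem lam_neg (σ : ℝ) (η : Bd d) : lam σ (-η) = lam σ η := by simp [lam]

theorem lam_sq_eq_sum (σ : ℝ) (η : Bd d) :
    lam σ η ^ 2 = ∑ i, (2 * Real.pi * η i) ^ 2 + σ ^ 2 := by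
  rw [lam_sq, mul_pow, EuclideanSpace.norm_sq_eq, Finset.mul_sum, add_comm]
  simp [mul_pow]

theorem contDiff_lam {σ : ℝ} (hσ : 0 < σ) : ContDiff ℝ ∞ (lam σ : Bd d → ℝ) := by
  have h : ContDiff ℝ ∞ (fun η : Bd d => σ ^ 2 + (2 * Real.pi) ^ 2 * ‖η‖ ^ 2) :=
    contDiff_const.add (contDiff_const.mul (contDiff_norm_sq ℝ))
  have := h.sqrt (fun η => by positivity)
  simp only [← mul_pow] at this
  exact this

theorem continuous_lam (σ : ℝ) : Continuous (lam σ : Bd d → ℝ) := by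
  unfold lam; fun_prop

/-- The squared weighted energy of a function on the half-space. -/
def energy (σ : ℝ) (φ : Bd d × ℝ → ℂ) : ℝ≥0∞ :=
  ∑ i, ∫⁻ p, ‖pderiv i φ p‖ₑ ^ 2 ∂(vol d) + ENNReal.ofReal (σ ^ 2) * ∫⁻ p, ‖φ p‖ₑ ^ 2 ∂(vol d)

/-- The spectral form of the squared minimal extension norm. -/
def spectralSq (σ : ℝ) (g : Lp ℂ 2 (volume : Measure (Bd d))) : ℝ≥0∞ :=
  ∫⁻ η, ENNReal.ofReal (lam σ η) * ‖(𝓕 g : Lp ℂ 2 (volume : Measure (Bd d))) η‖ₑ ^ 2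

/-- Since `-2l Re⟨F, G⟩ ≤ |G|² + l²|F|²` and the left side is `-l (|F|²)'`, integrating from `0` to
the zero `R` of `F` leaves `l|F 0|²`. Decaying exponentials are the equality case. -/
theorem ofReal_mul_enorm_sq_le {F G : ℝ → ℂ} {l R : ℝ} (hl : 0 ≤ l) (hR : 0 ≤ R)
    (hF : ∀ t, HasDerivAt F (G t) t) (hG : Continuous G) (h0 : F R = 0) :
    ENNReal.ofReal l * ‖F 0‖ₑ ^ 2 ≤
      ∫⁻ t in Set.Ioi (0 : ℝ), (‖G t‖ₑ ^ 2 + ENNReal.ofReal (l ^ 2) * ‖F t‖ₑ ^ 2) := by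
  have hFc : Continuous F := continuous_iff_continuousAt.2 fun t => (hF t).continuousAt
  have hd : ∀ t, HasDerivAt (fun t => ‖F t‖ ^ 2) (2 * inner ℝ (F t) (G t)) t := fun t =>
    (hF t).norm_sq
  have hint : ∫ t in (0 : ℝ)..R, 2 * inner ℝ (F t) (G t) = ‖F R‖ ^ 2 - ‖F 0‖ ^ 2 :=
    intervalIntegral.integral_eq_sub_of_hasDerivAt (fun t _ => hd t)
      ((continuous_const.mul (hFc.inner hG)).intervalIntegrable _ _)
  have hle : l * ‖F 0‖ ^ 2 ≤ ∫ t in (0 : ℝ)..R, (‖G t‖ ^ 2 + l ^ 2 * ‖F t‖ ^ 2) := by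
    have : l * ‖F 0‖ ^ 2 = ∫ t in (0 : ℝ)..R, (-l) * (2 * inner ℝ (F t) (G t)) := by
      rw [intervalIntegral.integral_const_mul, hint, h0]; simp
    rw [this]
    refine intervalIntegral.integral_mono_on hR (Continuous.intervalIntegrable (by fun_prop) _ _)
      (Continuous.intervalIntegrable (by fun_prop) _ _) fun t _ => ?_
    have h1 := abs_real_inner_le_norm (F t) (G t)
    have h2 := neg_le_of_abs_le h1
    nlinarith [sq_nonneg (‖G t‖ - l * ‖F t‖)]
  have e : ENNReal.ofReal l * ‖F 0‖ₑ ^ 2 = ENNReal.ofReal (l * ‖F 0‖ ^ 2) := by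
    rw [ENNReal.ofReal_mul hl, ENNReal.ofReal_pow (norm_nonneg _), ofReal_norm]
  have e2 (t : ℝ) : ‖G t‖ₑ ^ 2 + ENNReal.ofReal (l ^ 2) * ‖F t‖ₑ ^ 2 =
      ENNReal.ofReal (‖G t‖ ^ 2 + l ^ 2 * ‖F t‖ ^ 2) := by
    rw [ENNReal.ofReal_add (by positivity) (by positivity), ENNReal.ofReal_mul (by positivity),
      ENNReal.ofReal_pow (norm_nonneg (F t)), ENNReal.ofReal_pow (norm_nonneg (G t)),
      ofReal_norm, ofReal_norm]
  rw [e]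
  refine (ENNReal.ofReal_le_ofReal hle).trans ?_
  rw [intervalIntegral.integral_of_le hR, ofReal_integral_eq_lintegral_ofReal
    ((Continuous.integrableOn_Icc (by fun_prop)).mono_set Set.Ioc_subset_Icc_self)
    (Eventually.of_forall fun t => by positivity)]
  simp_rw [e2]
  exact lintegral_mono_set Set.Ioc_subset_Ioi_self

/-! ### Lower bound for compactly supported smooth functions. -/

section LowerBound

variable {φ : Bd d × ℝ → ℂ}

theorem eq_zero_of_notMem_fst_image (x : Bd d × ℝ) (hx : x.1 ∉ Prod.fst '' tsupport φ) :
    φ x = 0 :=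
  image_eq_zero_of_notMem_tsupport fun h => hx ⟨x, h, rfl⟩

theorem hasCompactSupport_slice (hc : HasCompactSupport φ) (t : ℝ) :
    HasCompactSupport (fun x => φ (x, t)) :=
  HasCompactSupport.intro (hc.isCompact.image continuous_fst)
    fun x hx => eq_zero_of_notMem_fst_image (x, t) hx

theorem contDiff_slice (hφ : ContDiff ℝ ∞ φ) (t : ℝ) : ContDiff ℝ ∞ (fun x => φ (x, t)) :=
  hφ.comp (contDiff_id.prodMk contDiff_const)

/-- Integration by parts on each slice. The sign is negative because the inverse kernel `exp (2πi
x·η)` is used here to pass from position to frequency. -/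
theorem tangentialFourierInv_pderiv_inl (hφ : ContDiff ℝ ∞ φ) (hc : HasCompactSupport φ)
    (i : Fin d) (p : Bd d × ℝ) :
    tangentialFourierInv (pderiv (Sum.inl i) φ) p =
      -(2 * Real.pi * Complex.I) * p.1 i * tangentialFourierInv φ p := by
  let f := (hasCompactSupport_slice hc p.2).toSchwartzMap (contDiff_slice hφ p.2)
  have h := DFunLike.congr_fun (SchwartzMap.fourierInv_lineDerivOp_eq f
    (EuclideanSpace.single i 1)) p.1
  have ht : (fun x : Bd d => inner ℝ x (EuclideanSpace.single i (1 : ℝ))).HasTemperateGrowth := by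
    fun_prop
  have e : (LineDeriv.lineDerivOp (EuclideanSpace.single i (1 : ℝ)) f : Bd d → ℂ) =
      fun x => pderiv (Sum.inl i) φ (x, p.2) := by
    ext x
    rw [SchwartzMap.lineDerivOp_apply_eq_fderiv]
    have h1 : HasFDerivAt (fun x => φ (x, p.2)) _ x :=
      ((hφ.differentiable (by simp)) (x, p.2)).hasFDerivAt.comp x
        (hasFDerivAt_prodMk_left x p.2)
    change fderiv ℝ (fun x => φ (x, p.2)) x _ = _
    rw [h1.fderiv]
    simp [pderiv, dir]
  rw [SchwartzMap.fourierInv_coe, e] at h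
  simp only [tangentialFourierInv]
  rw [h, smul_apply, SchwartzMap.smulLeftCLM_apply_apply ht,
    SchwartzMap.fourierInv_coe]
  simp [EuclideanSpace.inner_single_right, f, mul_assoc]
  exact Or.inl rfl

/-- This splits the zeroth-order term of the one-dimensional energy into the tangential derivatives
and the `σ²` term of the full energy. -/
theorem lam_sq_mul_tangentialFourierInv (hφ : ContDiff ℝ ∞ φ) (hc : HasCompactSupport φ) (σ : ℝ)
    (p : Bd d × ℝ) :
    ENNReal.ofReal (lam σ p.1 ^ 2) * ‖tangentialFourierInv φ p‖ₑ ^ 2 =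
      ∑ i, ‖tangentialFourierInv (pderiv (Sum.inl i) φ) p‖ₑ ^ 2 +
        ENNReal.ofReal (σ ^ 2) * ‖tangentialFourierInv φ p‖ₑ ^ 2 := by
  rw [lam_sq_eq_sum, ENNReal.ofReal_add (by positivity) (by positivity), add_mul,
    ENNReal.ofReal_sum_of_nonneg (fun _ _ => by positivity), Finset.sum_mul]
  congr 2 with i
  rw [tangentialFourierInv_pderiv_inl hφ hc, enorm_mul, mul_pow _ (‖_‖ₑ), ← ofReal_norm (_ * _),
    ← ENNReal.ofReal_pow (norm_nonneg _)]
  simp [abs_of_pos Real.pi_pos, mul_pow]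

theorem contDiff_tangentialFourierInv_of_compact (hφ : ContDiff ℝ ∞ φ)
    (hc : HasCompactSupport φ) : ContDiff ℝ ∞ (tangentialFourierInv φ) :=
  contDiff_tangentialFourierInv (hc.isCompact.image continuous_fst) hφ
    fun t η h => eq_zero_of_notMem_fst_image (η, t) h

theorem energy_eq_iterated (hφ : ContDiff ℝ ∞ φ) (σ : ℝ) :
    ∫⁻ t in Set.Ioi (0 : ℝ), ((∫⁻ x, ‖pderiv (Sum.inr ()) φ (x, t)‖ₑ ^ 2) +
            (∑ i, (∫⁻ x, ‖pderiv (Sum.inl i) φ (x, t)‖ₑ ^ 2) +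
        ENNReal.ofReal (σ ^ 2) * ∫⁻ x, ‖φ (x, t)‖ₑ ^ 2)) = energy σ φ := by
  have hm : ∀ i, Measurable fun p => ‖pderiv i φ p‖ₑ ^ 2 := fun i =>
    (contDiff_pderiv hφ i).continuous.measurable.enorm.pow_const 2
  have hm0 : Measurable fun p => ‖φ p‖ₑ ^ 2 := hφ.continuous.measurable.enorm.pow_const 2
  have hs : ∀ f : Bd d × ℝ → ℝ≥0∞, Measurable f → Measurable fun t => ∫⁻ x, f (x, t) :=
    fun f hf => hf.lintegral_prod_left'
  rw [energy, Fintype.sum_sum_type, lintegral_vol hm0]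
  simp_rw [lintegral_vol (hm _)]
  rw [lintegral_add_left (hs _ (hm _)),
    lintegral_add_left (Finset.measurable_sum _ fun i _ => hs _ (hm _)),
    lintegral_finsetSum _ (fun i _ => hs _ (hm _)), lintegral_const_mul _ (hs _ hm0)]
  simp [add_comm, add_assoc]

theorem lintegral_add_sum_mul {α ι : Type*} [MeasurableSpace α] [Fintype ι] {μ : Measure α}
    {a c : α → ℝ≥0∞} {b : ι → α → ℝ≥0∞} (ha : Measurable a) (hb : ∀ i, Measurable (b i))
    (hc : Measurable c) (r : ℝ≥0∞) :
    ∫⁻ x, (a x + (∑ i, b i x + r * c x)) ∂μ =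
      ∫⁻ x, a x ∂μ + (∑ i, ∫⁻ x, b i x ∂μ + r * ∫⁻ x, c x ∂μ) := by
  rw [lintegral_add_left ha, lintegral_add_left (Finset.measurable_sum _ fun i _ => hb i),
    lintegral_finsetSum _ (fun i _ => hb i), lintegral_const_mul _ hc]

theorem lintegral_enorm_sq_tangentialFourierInv (hφ : ContDiff ℝ ∞ φ) (hc : HasCompactSupport φ)
    (t : ℝ) : ∫⁻ η, ‖tangentialFourierInv φ (η, t)‖ₑ ^ 2 = ∫⁻ x, ‖φ (x, t)‖ₑ ^ 2 := by
  simp only [tangentialFourierInv]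
  exact lintegral_enorm_sq_fourierInv (contDiff_slice hφ t) (hasCompactSupport_slice hc t)

theorem measurable_enorm_sq_slice (hφ : Continuous φ) (t : ℝ) :
    Measurable fun η => ‖φ (η, t)‖ₑ ^ 2 := by
  have h : Continuous fun η => φ (η, t) := hφ.comp (Continuous.prodMk_left t)
  exact h.measurable.enorm.pow_const 2

theorem lintegral_tangentialFourierInv_eq_energy (hφ : ContDiff ℝ ∞ φ) (hc : HasCompactSupport φ)
    (σ : ℝ) : ∫⁻ t in Set.Ioi (0 : ℝ), ∫⁻ η,
          (‖tangentialFourierInv (pderiv (Sum.inr ()) φ) (η, t)‖ₑ ^ 2 +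
            (∑ i, ‖tangentialFourierInv (pderiv (Sum.inl i) φ) (η, t)‖ₑ ^ 2 +
        ENNReal.ofReal (σ ^ 2) * ‖tangentialFourierInv φ (η, t)‖ₑ ^ 2)) = energy σ φ := by
  have hF := contDiff_tangentialFourierInv_of_compact hφ hc
  have hG : ∀ i, ContDiff ℝ ∞ (tangentialFourierInv (pderiv i φ)) := fun i =>
    contDiff_tangentialFourierInv_of_compact (contDiff_pderiv hφ i) (hasCompactSupport_pderiv hc i)
  have hm : ∀ i t, Measurable fun η => ‖tangentialFourierInv (pderiv i φ) (η, t)‖ₑ ^ 2 :=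
    fun i t => measurable_enorm_sq_slice (hG i).continuous t
  have hm0 : ∀ t, Measurable fun η => ‖tangentialFourierInv φ (η, t)‖ₑ ^ 2 :=
    fun t => measurable_enorm_sq_slice hF.continuous t
  rw [← energy_eq_iterated hφ]
  refine lintegral_congr fun t => ?_
  rw [← lintegral_enorm_sq_tangentialFourierInv hφ hc]
  simp_rw [← fun i => lintegral_enorm_sq_tangentialFourierInv (contDiff_pderiv hφ i)
    (hasCompactSupport_pderiv hc i)]
  exact lintegral_add_sum_mul (hm _ t) (fun i => hm _ t) (hm0 t) _

theorem lintegral_lam_mul_le_energy (hφ : ContDiff ℝ ∞ φ) (hc : HasCompactSupport φ) (σ : ℝ) :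
    ∫⁻ η, ENNReal.ofReal (lam σ η) * ‖𝓕 (fun x => φ (x, 0)) η‖ₑ ^ 2 ≤ energy σ φ := by
  have hK : IsCompact (Prod.fst '' tsupport φ) := hc.isCompact.image continuous_fst
  have hs : ∀ t, ∀ η ∉ Prod.fst '' tsupport φ, φ (η, t) = 0 :=
    fun t η h => eq_zero_of_notMem_fst_image (η, t) h
  have hF : ContDiff ℝ ∞ (tangentialFourierInv φ) :=
    contDiff_tangentialFourierInv_of_compact hφ hc
  have hG : ∀ i, ContDiff ℝ ∞ (tangentialFourierInv (pderiv i φ)) := fun i =>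
    contDiff_tangentialFourierInv_of_compact (contDiff_pderiv hφ i) (hasCompactSupport_pderiv hc i)
  -- A height above the support of `φ`, serving as the endpoint at which the one-dimensional
  -- profiles vanish.
  obtain ⟨R, hR0, hR⟩ : ∃ R : ℝ, 0 ≤ R ∧ ∀ x, φ (x, R) = 0 := by
    obtain ⟨R, hR⟩ := (hc.isCompact.image continuous_snd).bddAbove
    refine ⟨max R 0 + 1, by positivity, fun x => image_eq_zero_of_notMem_tsupport fun h => ?_⟩
    have := hR ⟨_, h, rfl⟩
    have h2 := le_max_left R 0
    simp only at this
    linarith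
  calc ∫⁻ η, ENNReal.ofReal (lam σ η) * ‖𝓕 (fun x => φ (x, 0)) η‖ₑ ^ 2
      = ∫⁻ η, ENNReal.ofReal (lam σ η) * ‖tangentialFourierInv φ (η, 0)‖ₑ ^ 2 := by
        -- The forward and inverse transforms differ by the reflection `η ↦ -η`, under which `lam`
        -- is invariant.
        rw [← lintegral_neg_eq_self]
        simp [tangentialFourierInv, Real.fourierInv_eq_fourier_neg, lam_neg]
    _ ≤ ∫⁻ η, ∫⁻ t in Set.Ioi (0 : ℝ),
          (‖tangentialFourierInv (pderiv (Sum.inr ()) φ) (η, t)‖ₑ ^ 2 +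
            ENNReal.ofReal (lam σ η ^ 2) * ‖tangentialFourierInv φ (η, t)‖ₑ ^ 2) := by
        refine lintegral_mono fun η => ?_
        refine ofReal_mul_enorm_sq_le (F := fun t => tangentialFourierInv φ (η, t))
          (lam_nonneg σ η) hR0 (fun t => ?_)
          ((hG _).continuous.comp (Continuous.prodMk_right η)) ?_
        · rw [← pderiv_inr_tangentialFourierInv hK hφ hs]
          exact hasDerivAt_slice hF η t
        · simp [tangentialFourierInv, hR, Real.fourierInv_eq']
    _ = ∫⁻ t in Set.Ioi (0 : ℝ), ∫⁻ η,
          (‖tangentialFourierInv (pderiv (Sum.inr ()) φ) (η, t)‖ₑ ^ 2 +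
            (∑ i, ‖tangentialFourierInv (pderiv (Sum.inl i) φ) (η, t)‖ₑ ^ 2 +
        ENNReal.ofReal (σ ^ 2) * ‖tangentialFourierInv φ (η, t)‖ₑ ^ 2)) := by
        rw [lintegral_lintegral_swap]
        · simp_rw [← lam_sq_mul_tangentialFourierInv hφ hc σ]
        · have h1 := (hG (Sum.inr ())).continuous.measurable
          have h2 := hF.continuous.measurable
          have h3 := ((continuous_lam (d := d) σ).pow 2).measurable
          exact ((h1.enorm.pow_const 2).add ((h3.comp measurable_fst).ennreal_ofReal.mul
            (h2.enorm.pow_const 2))).aemeasurable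
    _ = energy σ φ := lintegral_tangentialFourierInv_eq_energy hφ hc σ

end LowerBound

end HalfSpace

/-! ### Passage of the lower bound to `H¹` functions. -/

namespace HalfSpace

variable {d : ℕ}

instance isLocallyFiniteMeasure_vol : IsLocallyFiniteMeasure (vol d) := by
  unfold vol; infer_instance

theorem tendsto_lintegral_enorm_sq {α : Type*} [MeasurableSpace α] {μ : Measure α}
    {f : ℕ → α → ℂ} {g : Lp ℂ 2 μ} (hf : ∀ k, MemLp (f k) 2 μ)
    (h : Tendsto (fun k => eLpNorm (fun x => f k x - g x) 2 μ) atTop (𝓝 0)) :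
    Tendsto (fun k => ∫⁻ x, ‖f k x‖ₑ ^ 2 ∂μ) atTop (𝓝 (ENNReal.ofReal (‖g‖ ^ 2))) := by
  have h1 := (Lp.tendsto_Lp_iff_tendsto_eLpNorm'' f hf g (Lp.memLp g)).2 h
  have e (k : ℕ) : ∫⁻ x, ‖f k x‖ₑ ^ 2 ∂μ = ENNReal.ofReal (‖(hf k).toLp (f k)‖ ^ 2) := by
    rw [← lintegral_enorm_sq_lp, lintegral_enorm_sq_congr (hf k).coeFn_toLp]
  simp_rw [e]
  have h2 := h1.norm.pow 2
  rw [Lp.toLp_coeFn] at h2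
  exact ENNReal.tendsto_ofReal h2

theorem tendsto_eLpNorm_fourier_sub {f : ℕ → Bd d → ℂ} {g : Lp ℂ 2 (volume : Measure (Bd d))}
    (hf : ∀ k, ContDiff ℝ ∞ (f k)) (hc : ∀ k, HasCompactSupport (f k))
    (h : Tendsto (fun k => eLpNorm (fun x => f k x - g x) 2 volume) atTop (𝓝 0)) :
    Tendsto (fun k => eLpNorm (fun η => 𝓕 (f k) η -
      (𝓕 g : Lp ℂ 2 (volume : Measure (Bd d))) η) 2 volume) atTop (𝓝 0) := by
  have hm : ∀ k, MemLp (f k) 2 volume := fun k =>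
    (hf k).continuous.memLp_of_hasCompactSupport (hc k)
  have h1 := (Lp.tendsto_Lp_iff_tendsto_eLpNorm'' f hm g (Lp.memLp g)).2 h
  rw [Lp.toLp_coeFn] at h1
  have h2 := ((Lp.fourierTransformₗᵢ (Bd d) ℂ).continuous.tendsto g).comp h1
  rw [Lp.tendsto_Lp_iff_tendsto_eLpNorm'] at h2
  refine h2.congr fun k => eLpNorm_congr_ae ?_
  exact (fourier_toLp_ae_eq (hf k) (hc k) (hm k)).sub (ae_eq_refl _)

theorem memLp_fourier {f : Bd d → ℂ} (hf : ContDiff ℝ ∞ f) (hc : HasCompactSupport f) :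
    MemLp (𝓕 f) 2 volume :=
  (Lp.memLp _).ae_eq (fourier_toLp_ae_eq hf hc (hf.continuous.memLp_of_hasCompactSupport hc))

theorem exists_seq_contDiff_tendsto (g : Lp ℂ 2 (volume : Measure (Bd d))) :
    ∃ f : ℕ → Bd d → ℂ, (∀ k, ContDiff ℝ ∞ (f k)) ∧ (∀ k, HasCompactSupport (f k)) ∧
      Tendsto (fun k => eLpNorm (fun x => f k x - g x) 2 volume) atTop (𝓝 0) := by
  choose f hc hf h using fun k : ℕ => (Lp.memLp g).exist_eLpNorm_sub_le (by simp) (by simp)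
    (Nat.one_div_pos_of_nat (α := ℝ) (n := k))
  refine ⟨f, hf, hc, ?_⟩
  refine tendsto_of_tendsto_of_tendsto_of_le_of_le tendsto_const_nhds
    (h := fun k : ℕ => ENNReal.ofReal (1 / ((k : ℝ) + 1))) ?_ (fun _ => zero_le) fun k => ?_
  · simpa using ENNReal.tendsto_ofReal (tendsto_one_div_add_atTop_nhds_zero_nat (𝕜 := ℝ))
  · have := h k
    rwa [eLpNorm_sub_comm] at this

theorem ofReal_wnorm_sq (v : H1 d) (σ : ℝ) : ENNReal.ofReal (v.wnorm σ) ^ 2 =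
    ∑ i, ENNReal.ofReal (‖v.grad i‖ ^ 2) +
      ENNReal.ofReal (σ ^ 2) * ENNReal.ofReal (‖v.val‖ ^ 2) := by
  rw [H1.wnorm, ← ENNReal.ofReal_pow (Real.sqrt_nonneg _), Real.sq_sqrt (by positivity),
    ENNReal.ofReal_add (by positivity) (by positivity), ENNReal.ofReal_mul (by positivity),
    ENNReal.ofReal_sum_of_nonneg (fun _ _ => by positivity)]

/-- The weight `lam` may be unbounded, so `L²` convergence of the transforms does not pass directly
to the weighted integrals. Fatou along an almost everywhere convergent subsequence gives the
inequality that is needed. -/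
theorem spectralSq_le_of_tendsto {σ : ℝ} {f : ℕ → Bd d → ℂ}
    {g : Lp ℂ 2 (volume : Measure (Bd d))} (hf : ∀ k, ContDiff ℝ ∞ (f k))
    (hc : ∀ k, HasCompactSupport (f k))
    (h : Tendsto (fun k => eLpNorm (fun x => f k x - g x) 2 volume) atTop (𝓝 0))
    {e : ℕ → ℝ≥0∞} {E : ℝ≥0∞} (he : ∀ k, ∫⁻ η, ENNReal.ofReal (lam σ η) * ‖𝓕 (f k) η‖ₑ ^ 2 ≤ e k)
    (hE : Tendsto e atTop (𝓝 E)) : spectralSq σ g ≤ E := by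
  have h1 := tendsto_eLpNorm_fourier_sub hf hc h
  obtain ⟨ns, hns, hae⟩ := (tendstoInMeasure_of_tendsto_eLpNorm two_ne_zero
    (fun k => (memLp_fourier (hf k) (hc k)).1) (Lp.memLp _).1 h1).exists_seq_tendsto_ae
  have hmeas : ∀ k, Measurable fun η => ENNReal.ofReal (lam σ η) * ‖𝓕 (f k) η‖ₑ ^ 2 := by
    intro k
    have : Continuous (𝓕 (f k)) :=
      (𝓕 ((hc k).toSchwartzMap (hf k)) : SchwartzMap (Bd d) ℂ).continuous
    exact (continuous_lam σ).measurable.ennreal_ofReal.mul (this.measurable.enorm.pow_const 2)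
  calc spectralSq σ g
      = ∫⁻ η, liminf (fun k => ENNReal.ofReal (lam σ η) * ‖𝓕 (f (ns k)) η‖ₑ ^ 2) atTop := by
        refine lintegral_congr_ae ?_
        filter_upwards [hae] with η hη
        refine (Tendsto.liminf_eq ?_).symm
        exact ENNReal.Tendsto.const_mul (ENNReal.Tendsto.pow hη.enorm)
          (Or.inr ENNReal.ofReal_ne_top)
    _ ≤ liminf (fun k => ∫⁻ η, ENNReal.ofReal (lam σ η) * ‖𝓕 (f (ns k)) η‖ₑ ^ 2) atTop :=
        lintegral_liminf_le fun k => hmeas _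
    _ ≤ liminf (fun k => e (ns k)) atTop := liminf_le_liminf (Eventually.of_forall fun k => he _)
    _ = E := (hE.comp hns.tendsto_atTop).liminf_eq

theorem spectralSq_le_wnorm_sq {v : H1 d} {g : Lp ℂ 2 (volume : Measure (Bd d))}
    (h : v.HasTrace g) (σ : ℝ) : spectralSq σ g ≤ ENNReal.ofReal (v.wnorm σ) ^ 2 := by
  obtain ⟨φ, hφ, h0, h1, h2⟩ := h
  refine spectralSq_le_of_tendsto (fun k => contDiff_slice (hφ k).1 0)
    (fun k => hasCompactSupport_slice (hφ k).2 0) h2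
    (fun k => lintegral_lam_mul_le_energy (hφ k).1 (hφ k).2 σ) ?_
  rw [ofReal_wnorm_sq]
  refine Tendsto.add (tendsto_finsetSum _ fun i _ => ?_) (ENNReal.Tendsto.const_mul ?_
    (Or.inr ENNReal.ofReal_ne_top))
  · exact tendsto_lintegral_enorm_sq (fun k => (contDiff_pderiv
      (hφ k).1 i).continuous.memLp_of_hasCompactSupport (hasCompactSupport_pderiv (hφ k).2 i))
      (h1 i)
  · exact tendsto_lintegral_enorm_sq
      (fun k => (hφ k).1.continuous.memLp_of_hasCompactSupport (hφ k).2) h0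

end HalfSpace

/-! ### The exponentially decaying extension and its energy. -/

namespace HalfSpace

variable {d : ℕ}

section Extension

/-- The decaying extension to the half-space whose boundary values have Fourier transform `h`. -/
def expExt (σ : ℝ) (h : Bd d → ℂ) : Bd d × ℝ → ℂ :=
  tangentialFourierInv fun q => Complex.exp ((-(lam σ q.1 * q.2) : ℝ) : ℂ) * h q.1

/-- The Fourier symbols of the partial derivatives of `expExt`. -/
def expSymbol (σ : ℝ) : Fin d ⊕ Unit → Bd d → ℂ
  | Sum.inl i, η => ((2 * Real.pi * η i : ℝ) : ℂ) * Complex.I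
  | Sum.inr _, η => -(lam σ η : ℂ)

variable {σ : ℝ} {h : Bd d → ℂ}

theorem contDiff_expSymbol (hσ : 0 < σ) (i : Fin d ⊕ Unit) :
    ContDiff ℝ ∞ (expSymbol (d := d) σ i) := by
  rcases i with i | _
  · have : ContDiff ℝ ∞ fun η : Bd d => η i := by fun_prop
    exact (Complex.ofRealCLM.contDiff.comp (contDiff_const.mul this)).mul contDiff_const
  · exact (Complex.ofRealCLM.contDiff.comp (contDiff_lam hσ)).neg

/-- The tangential symbols together with `σ²` give `λ²`, and the normal symbol gives another `λ²`.
-/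
theorem sum_enorm_expSymbol_sq (hσ : 0 < σ) (η : Bd d) :
    ∑ i, ‖expSymbol σ i η‖ₑ ^ 2 + ENNReal.ofReal (σ ^ 2) = ENNReal.ofReal (2 * lam σ η ^ 2) := by
  have h1 : ∀ i : Fin d ⊕ Unit, ‖expSymbol σ i η‖ₑ ^ 2 = ENNReal.ofReal (‖expSymbol σ i η‖ ^ 2) :=
    fun i => by rw [← ofReal_norm, ENNReal.ofReal_pow (norm_nonneg _)]
  simp_rw [h1]
  rw [← ENNReal.ofReal_sum_of_nonneg (fun _ _ => by positivity),
    ← ENNReal.ofReal_add (Finset.sum_nonneg fun _ _ => by positivity) (by positivity)]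
  congr 1
  rw [Fintype.sum_sum_type, two_mul]
  nth_rw 1 [lam_sq_eq_sum]
  simp [expSymbol, abs_of_pos Real.pi_pos, mul_pow, abs_of_pos (lam_pos hσ η)]
  ring

theorem contDiff_expExt_kernel (hσ : 0 < σ) (hh : ContDiff ℝ ∞ h) :
    ContDiff ℝ ∞ fun q : Bd d × ℝ => Complex.exp ((-(lam σ q.1 * q.2) : ℝ) : ℂ) * h q.1 := by
  have h1 : ContDiff ℝ ∞ fun q : Bd d × ℝ => -(lam σ q.1 * q.2) :=
    (((contDiff_lam hσ).comp contDiff_fst).mul contDiff_snd).neg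
  exact (Complex.ofRealCLM.contDiff.comp h1).cexp.mul (hh.comp contDiff_fst)

theorem expExt_kernel_eq_zero (t : ℝ) (η : Bd d) (hη : η ∉ tsupport h) :
    Complex.exp ((-(lam σ η * t) : ℝ) : ℂ) * h η = 0 := by
  rw [image_eq_zero_of_notMem_tsupport hη, mul_zero]

theorem contDiff_expExt (hσ : 0 < σ) (hh : ContDiff ℝ ∞ h) (hc : HasCompactSupport h) :
    ContDiff ℝ ∞ (expExt σ h) :=
  contDiff_tangentialFourierInv hc.isCompact (contDiff_expExt_kernel hσ hh)
    expExt_kernel_eq_zero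

theorem pderiv_expExt (hσ : 0 < σ) (hh : ContDiff ℝ ∞ h) (hc : HasCompactSupport h)
    (i : Fin d ⊕ Unit) :
    pderiv i (expExt σ h) = expExt σ fun η => expSymbol σ i η * h η := by
  ext1 p
  rcases i with i | _
  · rw [expExt, pderiv_inl_tangentialFourierInv hc.isCompact (contDiff_expExt_kernel hσ hh)
      expExt_kernel_eq_zero, expExt]
    congr 1
    ext1 q
    simp only [expSymbol]; ring
  · rw [expExt, pderiv_inr_tangentialFourierInv hc.isCompact (contDiff_expExt_kernel hσ hh)
      expExt_kernel_eq_zero, expExt]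
    congr 1
    ext1 ⟨η, t⟩
    have h1 := hasDerivAt_slice (contDiff_expExt_kernel hσ hh) η t
    have h2 : HasDerivAt (fun t : ℝ => -(lam σ η * t)) (-(lam σ η * 1)) t :=
      ((hasDerivAt_id t).const_mul (lam σ η)).neg
    have h3 := (h2.ofReal_comp.cexp).mul_const (h η)
    rw [h1.unique h3]
    simp only [expSymbol]; push_cast; ring

theorem expExt_sub {h' : Bd d → ℂ} (hh : ContDiff ℝ ∞ h) (hc : HasCompactSupport h)
    (hh' : ContDiff ℝ ∞ h') (hc' : HasCompactSupport h') :
    expExt σ (h - h') = expExt σ h - expExt σ h' := by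
  have key : ∀ (p : Bd d × ℝ) (f : Bd d → ℂ), ContDiff ℝ ∞ f → HasCompactSupport f →
      Integrable fun η => Complex.exp (((2 * Real.pi * inner ℝ η p.1 : ℝ) : ℂ) * Complex.I) *
        (Complex.exp ((-(lam σ η * p.2) : ℝ) : ℂ) * f η) := by
    intro p f hf hfc
    have := continuous_lam (d := d) σ
    have := hf.continuous
    refine Continuous.integrable_of_hasCompactSupport (by fun_prop) ?_
    exact (hfc.mul_left).mul_left
  ext1 p
  simp only [expExt, tangentialFourierInv_eq, Pi.sub_apply, mul_sub]
  exact integral_sub (key p h hh hc) (key p h' hh' hc')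

theorem lintegral_exp_sq_Ioi {l : ℝ} (hl : 0 < l) :
    ∫⁻ t in Set.Ioi (0 : ℝ), ‖Complex.exp ((-(l * t) : ℝ) : ℂ)‖ₑ ^ 2 =
      ENNReal.ofReal ((2 * l)⁻¹) := by
  have h1 : ∀ t : ℝ, ‖Complex.exp ((-(l * t) : ℝ) : ℂ)‖ₑ ^ 2 =
      ENNReal.ofReal (Real.exp (-(2 * l) * t)) := by
    intro t
    rw [← ofReal_norm, Complex.norm_exp_ofReal, ← ENNReal.ofReal_pow (Real.exp_pos _).le,
      ← Real.exp_nat_mul]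
    congr 2
    push_cast; ring
  have h2 : -(2 * l) < 0 := by linarith
  simp_rw [h1]
  rw [← ofReal_integral_eq_lintegral_ofReal (integrableOn_exp_mul_Ioi h2 0)
    (Eventually.of_forall fun t => (Real.exp_pos _).le), integral_exp_mul_Ioi h2 0]
  congr 1
  simp [neg_div_neg_eq]

/-- Plancherel on each slice, then Tonelli and `∫₀^∞ exp (-2λt) dt = 1/(2λ)`. -/
theorem lintegral_enorm_sq_expExt (hσ : 0 < σ) (hh : ContDiff ℝ ∞ h) (hc : HasCompactSupport h) :
    ∫⁻ p, ‖expExt σ h p‖ₑ ^ 2 ∂(vol d) =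
      ∫⁻ η, ENNReal.ofReal ((2 * lam σ η)⁻¹) * ‖h η‖ₑ ^ 2 := by
  have hm : Measurable fun p => ‖expExt σ h p‖ₑ ^ 2 :=
    (contDiff_expExt hσ hh hc).continuous.measurable.enorm.pow_const 2
  have hk : Measurable fun q : Bd d × ℝ =>
      ‖Complex.exp ((-(lam σ q.1 * q.2) : ℝ) : ℂ) * h q.1‖ₑ ^ 2 :=
    (contDiff_expExt_kernel hσ hh).continuous.measurable.enorm.pow_const 2
  calc ∫⁻ p, ‖expExt σ h p‖ₑ ^ 2 ∂(vol d)
      = ∫⁻ t in Set.Ioi (0 : ℝ), ∫⁻ η,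
          ‖Complex.exp ((-(lam σ η * t) : ℝ) : ℂ) * h η‖ₑ ^ 2 := by
        rw [lintegral_vol hm]
        refine lintegral_congr fun t => ?_
        simp only [expExt, tangentialFourierInv]
        refine lintegral_enorm_sq_fourierInv (contDiff_slice (contDiff_expExt_kernel hσ hh) t) ?_
        exact hc.mul_left
    _ = ∫⁻ η, ∫⁻ t in Set.Ioi (0 : ℝ),
          ‖Complex.exp ((-(lam σ η * t) : ℝ) : ℂ) * h η‖ₑ ^ 2 :=
        lintegral_lintegral_swap (hk.comp measurable_swap).aemeasurable
    _ = _ := by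
        refine lintegral_congr fun η => ?_
        simp_rw [enorm_mul, mul_pow]
        rw [lintegral_mul_const _ (by fun_prop), lintegral_exp_sq_Ioi (lam_pos hσ η)]

theorem contDiff_expSymbol_mul (hσ : 0 < σ) (hh : ContDiff ℝ ∞ h) (i : Fin d ⊕ Unit) :
    ContDiff ℝ ∞ fun η => expSymbol σ i η * h η := (contDiff_expSymbol hσ i).mul hh

/-- Each derivative multiplies `h` by its symbol, so the density is `(2λ)⁻¹ · 2λ² |h|² = λ|h|²`: the
lower bound is attained. -/
theorem energy_expExt (hσ : 0 < σ) (hh : ContDiff ℝ ∞ h) (hc : HasCompactSupport h) :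
    energy σ (expExt σ h) = ∫⁻ η, ENNReal.ofReal (lam σ η) * ‖h η‖ₑ ^ 2 := by
  have hs : ∀ i : Fin d ⊕ Unit, Continuous (expSymbol (d := d) σ i) := fun i =>
    (contDiff_expSymbol hσ i).continuous
  have hl := continuous_lam (d := d) σ
  have hl' : Measurable fun η : Bd d => ENNReal.ofReal ((2 * lam σ η)⁻¹) :=
    ((hl.measurable.const_mul 2).inv).ennreal_ofReal
  have hm : ∀ f : Bd d → ℂ, Continuous f →
      Measurable fun η => ENNReal.ofReal ((2 * lam σ η)⁻¹) * ‖f η‖ₑ ^ 2 := fun f hf =>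
    hl'.mul (hf.measurable.enorm.pow_const 2)
  have hi : ∀ i, ∫⁻ p, ‖pderiv i (expExt σ h) p‖ₑ ^ 2 ∂(vol d) =
      ∫⁻ η, ENNReal.ofReal ((2 * lam σ η)⁻¹) * ‖expSymbol σ i η * h η‖ₑ ^ 2 := fun i => by
    rw [pderiv_expExt hσ hh hc]
    exact lintegral_enorm_sq_expExt hσ (contDiff_expSymbol_mul hσ hh i) hc.mul_left
  rw [energy, lintegral_enorm_sq_expExt hσ hh hc, ← lintegral_const_mul _ (hm _ hh.continuous)]
  simp_rw [hi]
  rw [← lintegral_finsetSum _ fun i _ => hm (fun η => expSymbol σ i η * h η)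
    ((hs i).mul hh.continuous),
    ← lintegral_add_right _ ((hm _ hh.continuous).const_mul _)]
  refine lintegral_congr fun η => ?_
  have e := sum_enorm_expSymbol_sq hσ η
  have hp := lam_pos hσ η
  calc ∑ i, ENNReal.ofReal ((2 * lam σ η)⁻¹) * ‖expSymbol σ i η * h η‖ₑ ^ 2 +
        ENNReal.ofReal (σ ^ 2) * (ENNReal.ofReal ((2 * lam σ η)⁻¹) * ‖h η‖ₑ ^ 2)
      = ENNReal.ofReal ((2 * lam σ η)⁻¹) *
        (∑ i, ‖expSymbol σ i η‖ₑ ^ 2 + ENNReal.ofReal (σ ^ 2)) * ‖h η‖ₑ ^ 2 := by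
        simp_rw [enorm_mul, mul_pow]
        rw [mul_add, add_mul, Finset.mul_sum, Finset.sum_mul]
        congr 1
        · simp_rw [mul_assoc]
        · ring
    _ = _ := by
        rw [e, ← ENNReal.ofReal_mul (by positivity)]
        congr 2
        field_simp

theorem memLp_expExt (hσ : 0 < σ) (hh : ContDiff ℝ ∞ h) (hc : HasCompactSupport h) :
    MemLp (expExt σ h) 2 (vol d) := by
  refine ⟨(contDiff_expExt hσ hh hc).continuous.aestronglyMeasurable, ?_⟩
  have h1 : eLpNorm (expExt σ h) 2 (vol d) ^ 2 ≤
      ENNReal.ofReal ((2 * σ)⁻¹) * eLpNorm h 2 volume ^ 2 := by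
    rw [eLpNorm_two_sq, eLpNorm_two_sq, lintegral_enorm_sq_expExt hσ hh hc,
      ← lintegral_const_mul' _ _ ENNReal.ofReal_ne_top]
    refine lintegral_mono fun η => ?_
    gcongr
    exact le_lam η
  have h2 : eLpNorm h 2 volume < ⊤ := (hh.continuous.memLp_of_hasCompactSupport hc).2
  have h3 := h1.trans_lt (ENNReal.mul_lt_top ENNReal.ofReal_lt_top (ENNReal.pow_lt_top h2))
  exact (ENNReal.pow_lt_top_iff.1 h3).resolve_right (by norm_num)

theorem memLp_pderiv_expExt (hσ : 0 < σ) (hh : ContDiff ℝ ∞ h) (hc : HasCompactSupport h)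
    (i : Fin d ⊕ Unit) : MemLp (pderiv i (expExt σ h)) 2 (vol d) := by
  rw [pderiv_expExt hσ hh hc]
  exact memLp_expExt hσ (contDiff_expSymbol_mul hσ hh i) hc.mul_left

theorem expExt_zero (x : Bd d) : expExt σ h (x, 0) = 𝓕⁻ h x := by
  simp [expExt, tangentialFourierInv]

end Extension

end HalfSpace

/-! ### Cutoffs, integration by parts and limits of pairings. -/

namespace HalfSpace

variable {d : ℕ}

section Cutoff

theorem tendsto_eLpNorm_of_lintegral {α : Type*} [MeasurableSpace α] {μ : Measure α}
    {f : ℕ → α → ℂ} (h : Tendsto (fun k => ∫⁻ x, ‖f k x‖ₑ ^ 2 ∂μ) atTop (𝓝 0)) :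
    Tendsto (fun k => eLpNorm (f k) 2 μ) atTop (𝓝 0) := by
  have h1 := ((ENNReal.continuous_rpow_const (y := 1 / 2)).tendsto 0).comp h
  rw [ENNReal.zero_rpow_of_pos (by norm_num)] at h1
  refine h1.congr fun k => ?_
  rw [Function.comp_apply, ← eLpNorm_two_sq, ← ENNReal.rpow_natCast, ← ENNReal.rpow_mul]
  norm_num

/-- Dominated convergence; `|a k - 1| ≤ 2` yields the majorant `4|w|²`. -/
theorem tendsto_eLpNorm_mul_sub {α : Type*} [MeasurableSpace α] {μ : Measure α} {w : α → ℂ}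
    (hw : MemLp w 2 μ) {a : ℕ → α → ℂ} (ha : ∀ k, AEStronglyMeasurable (a k) μ)
    (hb : ∀ k x, ‖a k x‖ ≤ 1) (hlim : ∀ x, Tendsto (fun k => a k x) atTop (𝓝 1)) :
    Tendsto (fun k => eLpNorm (fun x => a k x * w x - w x) 2 μ) atTop (𝓝 0) := by
  refine tendsto_eLpNorm_of_lintegral ?_
  have hfin : ∫⁻ x, 4 * ‖w x‖ₑ ^ 2 ∂μ ≠ ⊤ := by
    rw [lintegral_const_mul' _ _ (by simp), ← eLpNorm_two_sq]
    exact ENNReal.mul_ne_top (by simp) (ENNReal.pow_ne_top hw.2.ne)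
  have h := tendsto_lintegral_of_dominated_convergence' (μ := μ)
    (F := fun k x => ‖a k x * w x - w x‖ₑ ^ 2) (f := fun _ => 0) (fun x => 4 * ‖w x‖ₑ ^ 2)
    (fun k => ((((ha k).mul hw.1).sub hw.1).enorm.pow_const 2))
    (fun k => Eventually.of_forall fun x => ?_) hfin (Eventually.of_forall fun x => ?_)
  · simpa using h
  · have e : a k x * w x - w x = (a k x - 1) * w x := by ring
    have h1 : ‖a k x - 1‖ ≤ 2 := by
      refine (norm_sub_le _ _).trans ?_
      rw [norm_one]; linarith [hb k x]
    simp only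
    rw [e, enorm_mul, mul_pow]
    gcongr
    rw [← ofReal_norm, ← ENNReal.ofReal_pow (norm_nonneg _)]
    refine (ENNReal.ofReal_le_ofReal (pow_le_pow_left₀ (norm_nonneg _) h1 2)).trans ?_
    norm_num
  · have h1 : Tendsto (fun k => a k x * w x - w x) atTop (𝓝 (1 * w x - w x)) :=
      ((hlim x).mul_const _).sub_const _
    have h2 := ENNReal.Tendsto.pow (n := 2) h1.enorm
    simpa using h2

/-- A fixed smooth bump function at the origin. -/
def bump (d : ℕ) : ContDiffBump (0 : Bd d × ℝ) := ⟨1, 2, one_pos, one_lt_two⟩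

/-- Smooth cutoff functions that exhaust the space. -/
def cutoff (k : ℕ) (p : Bd d × ℝ) : ℂ := (bump d (((k : ℝ) + 1)⁻¹ • p) : ℝ)

theorem contDiff_cutoff (k : ℕ) : ContDiff ℝ ∞ (cutoff (d := d) k) :=
  Complex.ofRealCLM.contDiff.comp ((bump d).contDiff.comp (contDiff_const_smul _))

theorem hasCompactSupport_cutoff (k : ℕ) : HasCompactSupport (cutoff (d := d) k) := by
  have hk : ((k : ℝ) + 1)⁻¹ ≠ 0 := by positivity
  have h : HasCompactSupport fun p : Bd d × ℝ => bump d (((k : ℝ) + 1)⁻¹ • p) :=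
    (bump d).hasCompactSupport.comp_homeomorph (Homeomorph.smulOfNeZero _ hk)
  exact h.comp_left (g := fun r : ℝ => (r : ℂ)) (by simp)

theorem norm_cutoff_le (k : ℕ) (p : Bd d × ℝ) : ‖cutoff k p‖ ≤ 1 := by
  rw [cutoff, Complex.norm_real, Real.norm_of_nonneg (bump d).nonneg]
  exact (bump d).le_one

theorem tendsto_inv_add_one : Tendsto (fun k : ℕ => ((k : ℝ) + 1)⁻¹) atTop (𝓝 0) := by
  simpa using tendsto_one_div_add_atTop_nhds_zero_nat (𝕜 := ℝ)

theorem tendsto_cutoff (p : Bd d × ℝ) : Tendsto (fun k => cutoff k p) atTop (𝓝 1) := by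
  have h1 : Tendsto (fun k : ℕ => ((k : ℝ) + 1)⁻¹ • p) atTop (𝓝 0) := by
    simpa using tendsto_inv_add_one.smul_const p
  have h2 := ((Complex.continuous_ofReal.comp (bump d).continuous).tendsto 0).comp h1
  rwa [Function.comp_apply, (bump d).one_of_mem_closedBall (by simp [bump]),
    Complex.ofReal_one] at h2

/-- The chain rule for the dilation gives the factor `1/(k+1)`, and `C` bounds the derivative of the
fixed bump. This decay removes the commutator term when a function is truncated. -/
theorem exists_norm_pderiv_cutoff_le (i : Fin d ⊕ Unit) : ∃ C : ℝ, 0 ≤ C ∧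
    ∀ k p, ‖pderiv i (cutoff (d := d) k) p‖ ≤ C * ((k : ℝ) + 1)⁻¹ := by
  have hb : ContDiff ℝ ∞ fun p : Bd d × ℝ => ((bump d p : ℝ) : ℂ) :=
    Complex.ofRealCLM.contDiff.comp (bump d).contDiff
  have hbc : HasCompactSupport fun p : Bd d × ℝ => ((bump d p : ℝ) : ℂ) :=
    (bump d).hasCompactSupport.comp_left (g := fun r : ℝ => (r : ℂ)) (by simp)
  obtain ⟨C, hC⟩ := (hasCompactSupport_pderiv hbc i).exists_bound_of_continuous
    (contDiff_pderiv hb i).continuous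
  refine ⟨C, (norm_nonneg _).trans (hC 0), fun k p => ?_⟩
  have h1 := (hb.differentiable (by simp) (((k : ℝ) + 1)⁻¹ • p)).hasFDerivAt.comp p
    ((hasFDerivAt_id p).const_smul ((k : ℝ) + 1)⁻¹)
  have h2 : pderiv i (cutoff (d := d) k) p =
      (((k : ℝ) + 1)⁻¹ : ℝ) • pderiv i (fun p : Bd d × ℝ => ((bump d p : ℝ) : ℂ))
        (((k : ℝ) + 1)⁻¹ • p) := by
    have h3 : fderiv ℝ (cutoff (d := d) k) p = _ := h1.fderiv
    rw [pderiv, h3, pderiv]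
    simp
  rw [h2, norm_smul, Real.norm_of_nonneg (by positivity), mul_comm]
  gcongr
  exact hC _

theorem pderiv_mul {a u : Bd d × ℝ → ℂ} (ha : ContDiff ℝ ∞ a) (hu : ContDiff ℝ ∞ u)
    (i : Fin d ⊕ Unit) (p : Bd d × ℝ) :
    pderiv i (fun p => a p * u p) p = a p * pderiv i u p + u p * pderiv i a p := by
  simp only [pderiv]
  rw [fderiv_fun_mul (ha.differentiable (by simp) p) (hu.differentiable (by simp) p)]
  simp

/-- A smooth function of finite energy on the half-space, with trace in `L²`, is a limit of
compactly supported ones. -/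
theorem exists_seq_hasCompactSupport_tendsto {u : Bd d × ℝ → ℂ} (hu : ContDiff ℝ ∞ u)
    (h0 : MemLp u 2 (vol d)) (h1 : ∀ i, MemLp (pderiv i u) 2 (vol d))
    (h2 : MemLp (fun x => u (x, 0)) 2 volume) :
    ∃ φ : ℕ → Bd d × ℝ → ℂ, (∀ k, ContDiff ℝ ∞ (φ k) ∧ HasCompactSupport (φ k)) ∧
      Tendsto (fun k => eLpNorm (fun p => φ k p - u p) 2 (vol d)) atTop (𝓝 0) ∧
      (∀ i, Tendsto (fun k => eLpNorm (fun p => pderiv i (φ k) p - pderiv i u p) 2 (vol d))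
        atTop (𝓝 0)) ∧
      Tendsto (fun k => eLpNorm (fun x => φ k (x, 0) - u (x, 0)) 2 volume) atTop (𝓝 0) := by
  refine ⟨fun k p => cutoff k p * u p, fun k => ⟨(contDiff_cutoff k).mul hu,
    (hasCompactSupport_cutoff k).mul_right⟩, ?_, fun i => ?_, ?_⟩
  · exact tendsto_eLpNorm_mul_sub h0
      (fun k => (contDiff_cutoff k).continuous.aestronglyMeasurable) norm_cutoff_le tendsto_cutoff
  · obtain ⟨C, hC0, hC⟩ := exists_norm_pderiv_cutoff_le i
    have t1 := tendsto_eLpNorm_mul_sub (h1 i)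
      (fun k => (contDiff_cutoff k).continuous.aestronglyMeasurable) norm_cutoff_le tendsto_cutoff
    have t2 : Tendsto (fun k : ℕ => ENNReal.ofReal (C * ((k : ℝ) + 1)⁻¹) * eLpNorm u 2 (vol d))
        atTop (𝓝 0) := by
      have := ENNReal.Tendsto.mul_const (b := eLpNorm u 2 (vol d))
        (ENNReal.tendsto_ofReal (tendsto_inv_add_one.const_mul C)) (Or.inr h0.2.ne)
      simpa using this
    have t3 := t1.add t2
    rw [add_zero] at t3
    refine tendsto_of_tendsto_of_tendsto_of_le_of_le tendsto_const_nhds t3 (fun _ => zero_le)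
      fun k => ?_
    -- By the Leibniz rule the error is a truncation error of `pderiv i u`, plus a term of norm at
    -- most `C/(k+1)` times that of `u`.
    have e : (fun p => pderiv i (fun p => cutoff k p * u p) p - pderiv i u p) =
        (fun p => cutoff k p * pderiv i u p - pderiv i u p) +
          fun p => u p * pderiv i (cutoff k) p := by
      ext1 p
      rw [pderiv_mul (contDiff_cutoff k) hu, Pi.add_apply]; ring
    simp only
    rw [e]
    have hck := (contDiff_cutoff (d := d) k).continuous
    have hcd := (contDiff_pderiv (contDiff_cutoff (d := d) k) i).continuous
    have hud := (contDiff_pderiv hu i).continuous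
    have huc := hu.continuous
    refine (eLpNorm_add_le (by fun_prop) (by fun_prop) (by simp)).trans ?_
    gcongr
    refine eLpNorm_le_mul_eLpNorm_of_ae_le_mul (Eventually.of_forall fun p => ?_) 2
    rw [norm_mul, mul_comm]
    gcongr
    exact hC k p
  · exact tendsto_eLpNorm_mul_sub (a := fun k x => cutoff k (x, 0)) h2
      (fun k => (contDiff_slice (contDiff_cutoff k) 0).continuous.aestronglyMeasurable)
      (fun k x => norm_cutoff_le k _) (fun x => tendsto_cutoff _)

end Cutoff

section Weak

/-- The support of `θ` stays inside the open half-space, so both integrals equal those over the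
whole space and no boundary term appears. -/
theorem integral_mul_pderiv {u θ : Bd d × ℝ → ℂ} (hu : ContDiff ℝ ∞ u) (hθ : ContDiff ℝ ∞ θ)
    (hc : HasCompactSupport θ) (hs : tsupport θ ⊆ upper d) (i : Fin d ⊕ Unit) :
    ∫ p, u p * pderiv i θ p ∂(vol d) = -∫ p, pderiv i u p * θ p ∂(vol d) := by
  have huc := hu.continuous
  have hud := (contDiff_pderiv hu i).continuous
  have hθd := (contDiff_pderiv hθ i).continuous
  have hθc := hθ.continuous
  have h := integral_mul_fderiv_eq_neg_fderiv_mul_of_integrable (f := u) (g := θ) (v := dir i)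
    (μ := (volume : Measure (Bd d)).prod (volume : Measure ℝ))
    (Continuous.integrable_of_hasCompactSupport (hud.mul hθc) hc.mul_left)
    (Continuous.integrable_of_hasCompactSupport (huc.mul hθd)
      (hasCompactSupport_pderiv hc i).mul_left)
    (Continuous.integrable_of_hasCompactSupport (huc.mul hθc) hc.mul_left)
    (fun x _ => hu.differentiable (by simp) x) (fun x _ => hθ.differentiable (by simp) x)
  have e1 : ∫ p, u p * pderiv i θ p ∂(vol d) = ∫ p, u p * pderiv i θ p := by
    refine setIntegral_eq_integral_of_forall_compl_eq_zero fun p hp => ?_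
    have h1 : p ∉ tsupport (fderiv ℝ θ) := fun h' => hp (hs (tsupport_fderiv_subset ℝ h'))
    rw [pderiv, image_eq_zero_of_notMem_tsupport h1]; simp
  have e2 : ∫ p, pderiv i u p * θ p ∂(vol d) = ∫ p, pderiv i u p * θ p := by
    refine setIntegral_eq_integral_of_forall_compl_eq_zero fun p hp => ?_
    rw [image_eq_zero_of_notMem_tsupport fun h' => hp (hs h'), mul_zero]
  rw [e1, e2]
  exact h

/-- The integral is the `L²` inner product with the conjugate of `w`, which is continuous. -/
theorem tendsto_integral_mul {α : Type*} [MeasurableSpace α] {μ : Measure α}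
    {f : ℕ → α → ℂ} {g : Lp ℂ 2 μ} (hf : ∀ k, MemLp (f k) 2 μ)
    (h : Tendsto (fun k => eLpNorm (fun x => f k x - g x) 2 μ) atTop (𝓝 0))
    {w : α → ℂ} (hw : MemLp w 2 μ) :
    Tendsto (fun k => ∫ x, f k x * w x ∂μ) atTop (𝓝 (∫ x, g x * w x ∂μ)) := by
  have h1 := (Lp.tendsto_Lp_iff_tendsto_eLpNorm'' f hf g (Lp.memLp g)).2 h
  rw [Lp.toLp_coeFn] at h1
  have hw' : MemLp (fun x => (starRingEnd ℂ) (w x)) 2 μ := hw.star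
  have key : ∀ G : Lp ℂ 2 μ, inner ℂ (hw'.toLp _) G = ∫ x, G x * w x ∂μ := by
    intro G
    rw [L2.inner_def]
    refine integral_congr_ae ?_
    filter_upwards [hw'.coeFn_toLp] with x hx
    rw [hx]
    simp
  have h2 := (tendsto_const_nhds (x := hw'.toLp _)).inner (𝕜 := ℂ) h1
  simp_rw [key] at h2
  refine h2.congr fun k => integral_congr_ae ?_
  filter_upwards [(hf k).coeFn_toLp] with x hx
  rw [hx]

end Weak

end HalfSpace

/-! ### Construction of the minimizer. -/

namespace HalfSpace

variable {d : ℕ} {σ : ℝ}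

/-- Division by the square root of the frequency weight. -/
def whiten (σ : ℝ) (ψ : Bd d → ℂ) (η : Bd d) : ℂ := (((√(lam σ η))⁻¹ : ℝ) : ℂ) * ψ η

theorem contDiff_whiten (hσ : 0 < σ) {ψ : Bd d → ℂ} (hψ : ContDiff ℝ ∞ ψ) :
    ContDiff ℝ ∞ (whiten σ ψ) := by
  have h1 : ContDiff ℝ ∞ fun η : Bd d => √(lam σ η) :=
    (contDiff_lam hσ).sqrt fun η => (lam_pos hσ η).ne'
  have h2 : ContDiff ℝ ∞ fun η : Bd d => (√(lam σ η))⁻¹ :=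
    h1.inv fun η => (Real.sqrt_pos.2 (lam_pos hσ η)).ne'
  exact (Complex.ofRealCLM.contDiff.comp h2).mul hψ

theorem hasCompactSupport_whiten {ψ : Bd d → ℂ} (hc : HasCompactSupport ψ) :
    HasCompactSupport (whiten σ ψ) := hc.mul_left

theorem whiten_sub (ψ ψ' : Bd d → ℂ) : whiten σ (ψ - ψ') = whiten σ ψ - whiten σ ψ' := by
  ext1 η; simp [whiten, mul_sub]

theorem lam_mul_enorm_whiten_sq (hσ : 0 < σ) (ψ : Bd d → ℂ) (η : Bd d) :
    ENNReal.ofReal (lam σ η) * ‖whiten σ ψ η‖ₑ ^ 2 = ‖ψ η‖ₑ ^ 2 := by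
  have hl := lam_pos hσ η
  rw [whiten, enorm_mul, mul_pow, ← mul_assoc, ← ofReal_norm (((√(lam σ η))⁻¹ : ℝ) : ℂ),
    Complex.norm_real, Real.norm_of_nonneg (by positivity), ← ENNReal.ofReal_pow (by positivity),
    ← ENNReal.ofReal_mul hl.le, inv_pow, Real.sq_sqrt hl.le, mul_inv_cancel₀ hl.ne',
    ENNReal.ofReal_one, one_mul]

theorem norm_whiten_le (hσ : 0 < σ) (ψ : Bd d → ℂ) (η : Bd d) :
    ‖whiten σ ψ η‖ ≤ (√σ)⁻¹ * ‖ψ η‖ := by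
  rw [whiten, norm_mul, Complex.norm_real, Real.norm_of_nonneg (by positivity)]
  gcongr
  exact le_lam η

/-- The factor `λ^{-1/2}` absorbs the weight, so the `L²` norm of `ψ` controls the whole `H¹` norm
of the extension. -/
theorem energy_expExt_whiten (hσ : 0 < σ) {ψ : Bd d → ℂ} (hψ : ContDiff ℝ ∞ ψ)
    (hc : HasCompactSupport ψ) :
    energy σ (expExt σ (whiten σ ψ)) = ∫⁻ η, ‖ψ η‖ₑ ^ 2 := by
  rw [energy_expExt hσ (contDiff_whiten hσ hψ) (hasCompactSupport_whiten hc)]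
  simp_rw [lam_mul_enorm_whiten_sq hσ]

/-- Completeness of `L²`, for functions depending in a Lipschitz way on a Cauchy sequence. -/
theorem exists_tendsto_eLpNorm {α β : Type*} [MeasurableSpace α] [MeasurableSpace β]
    {μ : Measure α} {ν : Measure β} {w : ℕ → α → ℂ} (hw : ∀ k, MemLp (w k) 2 μ)
    {P : ℕ → Lp ℂ 2 ν} (hP : CauchySeq P) (c : ℝ≥0∞) (hc : c ≠ ⊤)
    (h : ∀ k l, eLpNorm (w k - w l) 2 μ ≤ c * ‖P k - P l‖ₑ) :
    ∃ V : Lp ℂ 2 μ, Tendsto (fun k => eLpNorm (fun x => w k x - V x) 2 μ) atTop (𝓝 0) := by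
  have hC : CauchySeq fun k => (hw k).toLp (w k) := by
    rw [cauchySeq_iff_tendsto_dist_atTop_0] at hP ⊢
    have h0 := hP.const_mul c.toReal
    rw [mul_zero] at h0
    refine squeeze_zero (fun _ => dist_nonneg) (fun q => ?_) h0
    rw [dist_eq_norm, dist_eq_norm, ← MemLp.toLp_sub (hw q.1) (hw q.2), Lp.norm_toLp,
      ← toReal_enorm (P q.1 - P q.2), ← ENNReal.toReal_mul]
    exact ENNReal.toReal_mono (ENNReal.mul_ne_top hc enorm_ne_top) (h q.1 q.2)
  obtain ⟨V, hV⟩ := cauchySeq_tendsto_of_complete hC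
  refine ⟨V, (Lp.tendsto_Lp_iff_tendsto_eLpNorm'' w hw V (Lp.memLp V)).1 ?_⟩
  rwa [Lp.toLp_coeFn]

theorem eLpNorm_le_of_lintegral_le {α β : Type*} [MeasurableSpace α] [MeasurableSpace β]
    {μ : Measure α} {ν : Measure β} {f : α → ℂ} {g : β → ℂ}
    (h : ∫⁻ x, ‖f x‖ₑ ^ 2 ∂μ ≤ ∫⁻ x, ‖g x‖ₑ ^ 2 ∂ν) : eLpNorm f 2 μ ≤ eLpNorm g 2 ν := by
  rw [← eLpNorm_two_sq, ← eLpNorm_two_sq] at h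
  exact (ENNReal.pow_right_strictMono two_ne_zero).le_iff_le.1 h

theorem eLpNorm_pderiv_expExt_whiten_le (hσ : 0 < σ) {ψ : Bd d → ℂ} (hψ : ContDiff ℝ ∞ ψ)
    (hc : HasCompactSupport ψ) (i : Fin d ⊕ Unit) :
    eLpNorm (pderiv i (expExt σ (whiten σ ψ))) 2 (vol d) ≤ eLpNorm ψ 2 volume := by
  refine eLpNorm_le_of_lintegral_le ?_
  rw [← energy_expExt_whiten hσ hψ hc, energy]
  exact (Finset.single_le_sum (f := fun i => ∫⁻ p, ‖pderiv i (expExt σ (whiten σ ψ)) p‖ₑ ^ 2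
    ∂(vol d)) (fun _ _ => zero_le) (Finset.mem_univ i)).trans le_self_add

theorem eLpNorm_expExt_whiten_le (hσ : 0 < σ) {ψ : Bd d → ℂ} (hψ : ContDiff ℝ ∞ ψ)
    (hc : HasCompactSupport ψ) :
    eLpNorm (expExt σ (whiten σ ψ)) 2 (vol d) ≤ ENNReal.ofReal σ⁻¹ * eLpNorm ψ 2 volume := by
  have h0 : ENNReal.ofReal σ * eLpNorm (expExt σ (whiten σ ψ)) 2 (vol d) ≤
      eLpNorm ψ 2 volume := by
    refine (ENNReal.pow_right_strictMono two_ne_zero).le_iff_le.1 ?_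
    rw [mul_pow, eLpNorm_two_sq, eLpNorm_two_sq, ← energy_expExt_whiten hσ hψ hc, energy,
      ENNReal.ofReal_pow hσ.le]
    exact le_add_self
  calc eLpNorm (expExt σ (whiten σ ψ)) 2 (vol d)
      = ENNReal.ofReal σ⁻¹ * (ENNReal.ofReal σ * eLpNorm (expExt σ (whiten σ ψ)) 2 (vol d)) := by
        rw [← mul_assoc, ← ENNReal.ofReal_mul (by positivity), inv_mul_cancel₀ hσ.ne',
          ENNReal.ofReal_one, one_mul]
    _ ≤ _ := by gcongr

theorem pderiv_sub {u v : Bd d × ℝ → ℂ} (hu : ContDiff ℝ ∞ u) (hv : ContDiff ℝ ∞ v)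
    (i : Fin d ⊕ Unit) : pderiv i (u - v) = pderiv i u - pderiv i v := by
  ext1 p
  simp only [pderiv, Pi.sub_apply]
  rw [fderiv_sub (hu.differentiable (by simp) p) (hv.differentiable (by simp) p)]
  simp

theorem tendsto_eLpNorm_fourierInv_sub {f : ℕ → Bd d → ℂ}
    {g : Lp ℂ 2 (volume : Measure (Bd d))}
    (hf : ∀ k, ContDiff ℝ ∞ (f k)) (hc : ∀ k, HasCompactSupport (f k))
    (h : Tendsto (fun k => eLpNorm (fun x => f k x - g x) 2 volume) atTop (𝓝 0)) :
    Tendsto (fun k => eLpNorm (fun η => 𝓕⁻ (f k) η -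
      (𝓕⁻ g : Lp ℂ 2 (volume : Measure (Bd d))) η) 2 volume) atTop (𝓝 0) := by
  have hm : ∀ k, MemLp (f k) 2 volume := fun k =>
    (hf k).continuous.memLp_of_hasCompactSupport (hc k)
  have h1 := (Lp.tendsto_Lp_iff_tendsto_eLpNorm'' f hm g (Lp.memLp g)).2 h
  rw [Lp.toLp_coeFn] at h1
  have h2 := ((Lp.fourierTransformₗᵢ (Bd d) ℂ).symm.continuous.tendsto g).comp h1
  rw [Lp.tendsto_Lp_iff_tendsto_eLpNorm'] at h2
  refine h2.congr fun k => eLpNorm_congr_ae ?_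
  have h3 : ((Lp.fourierTransformₗᵢ (Bd d) ℂ).symm ((hm k).toLp (f k)) : Bd d → ℂ)
      =ᵐ[volume] 𝓕⁻ (f k) := by
    have h4 := SchwartzMap.toLp_fourierInv_eq ((hc k).toSchwartzMap (hf k))
    change ((𝓕⁻ (((hc k).toSchwartzMap (hf k)).toLp 2) : Lp ℂ 2 (volume : Measure (Bd d))) :
      Bd d → ℂ) =ᵐ[volume] _
    rw [h4]
    refine (SchwartzMap.coeFn_toLp _ _ _).trans (Eventually.of_forall fun x => ?_)
    rw [SchwartzMap.fourierInv_coe]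
    rfl
  exact h3.sub (ae_eq_refl _)

/-- Smooth functions on the half-space that converge to the minimizer. -/
theorem exists_seq_whiten (hσ : 0 < σ) {g : Lp ℂ 2 (volume : Measure (Bd d))}
    (hg : spectralSq σ g ≠ ⊤) :
    ∃ (ψ : ℕ → Bd d → ℂ) (Ψ : Lp ℂ 2 (volume : Measure (Bd d))),
      (∀ k, ContDiff ℝ ∞ (ψ k)) ∧ (∀ k, HasCompactSupport (ψ k)) ∧
      Tendsto (fun k => eLpNorm (fun x => ψ k x - Ψ x) 2 volume) atTop (𝓝 0) ∧
      ENNReal.ofReal (‖Ψ‖ ^ 2) = spectralSq σ g ∧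
      Tendsto (fun k => eLpNorm (fun x => 𝓕⁻ (whiten σ (ψ k)) x - g x) 2 volume)
        atTop (𝓝 0) := by
  set G : Lp ℂ 2 (volume : Measure (Bd d)) := 𝓕 g with hG
  -- The target is `λ^{1/2} 𝓕 g`, square integrable because `spectralSq σ g` is finite.
  -- Approximating it, rather than `𝓕 g`, gives convergence in energy; `λ ≥ σ > 0` then gives
  -- convergence of the boundary values as well.
  set F : Bd d → ℂ := fun η => ((√(lam σ η) : ℝ) : ℂ) * G η with hF
  have hFsq : ∀ η, ‖F η‖ₑ ^ 2 = ENNReal.ofReal (lam σ η) * ‖G η‖ₑ ^ 2 := by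
    intro η
    rw [hF, enorm_mul, mul_pow, ← ofReal_norm, Complex.norm_real,
      Real.norm_of_nonneg (Real.sqrt_nonneg _), ← ENNReal.ofReal_pow (Real.sqrt_nonneg _),
      Real.sq_sqrt (lam_nonneg σ η)]
  have hFint : ∫⁻ η, ‖F η‖ₑ ^ 2 = spectralSq σ g := lintegral_congr hFsq
  have hFm : MemLp F 2 volume := by
    refine ⟨AEStronglyMeasurable.mul ?_ (Lp.memLp G).1, ?_⟩
    · have h1 : Continuous fun η : Bd d => √(lam σ η) := (continuous_lam σ).sqrt
      exact (Complex.continuous_ofReal.comp h1).aestronglyMeasurable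
    · have h1 : eLpNorm F 2 volume ^ 2 < ⊤ := by
        rw [eLpNorm_two_sq, hFint]; exact hg.lt_top
      exact (ENNReal.pow_lt_top_iff.1 h1).resolve_right (by norm_num)
  obtain ⟨ψ, hψ, hc, ht⟩ := exists_seq_contDiff_tendsto (hFm.toLp F)
  refine ⟨ψ, hFm.toLp F, hψ, hc, ht, ?_, ?_⟩
  · rw [← lintegral_enorm_sq_lp, lintegral_enorm_sq_congr hFm.coeFn_toLp, hFint]
  · have ht2 : Tendsto (fun k => eLpNorm (fun x => whiten σ (ψ k) x - G x) 2 volume)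
        atTop (𝓝 0) := by
      have h2 := ENNReal.Tendsto.const_mul ht (a := ENNReal.ofReal (√σ)⁻¹)
        (Or.inr ENNReal.ofReal_ne_top)
      rw [mul_zero] at h2
      refine tendsto_of_tendsto_of_tendsto_of_le_of_le tendsto_const_nhds h2 (fun _ => zero_le)
        fun k => ?_
      refine eLpNorm_le_mul_eLpNorm_of_ae_le_mul ?_ 2
      filter_upwards [hFm.coeFn_toLp] with η hη
      have hs : ((√(lam σ η) : ℝ) : ℂ) ≠ 0 := by
        exact_mod_cast (Real.sqrt_pos.2 (lam_pos hσ η)).ne'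
      have e : whiten σ (ψ k) η - G η = whiten σ (fun η => ψ k η - F η) η := by
        simp only [whiten, hF, mul_sub, Complex.ofReal_inv]
        rw [inv_mul_cancel_left₀ hs]
      rw [hη, e]
      exact norm_whiten_le hσ _ η
    have h3 := tendsto_eLpNorm_fourierInv_sub (fun k => contDiff_whiten hσ (hψ k))
      (fun k => hasCompactSupport_whiten (hc k)) ht2
    have h4 : (𝓕⁻ G : Lp ℂ 2 (volume : Measure (Bd d))) = g :=
      FourierTransform.fourierInv_fourier_eq g
    rwa [h4] at h3

theorem tendsto_eLpNorm_trans {α : Type*} [MeasurableSpace α] {μ : Measure α}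
    {a b : ℕ → α → ℂ} {c : α → ℂ} (ha : ∀ k, AEStronglyMeasurable (a k) μ)
    (hb : ∀ k, AEStronglyMeasurable (b k) μ) (hc : AEStronglyMeasurable c μ)
    (h1 : ∀ k : ℕ, eLpNorm (fun x => a k x - b k x) 2 μ ≤ ENNReal.ofReal ((k : ℝ) + 1)⁻¹)
    (h2 : Tendsto (fun k => eLpNorm (fun x => b k x - c x) 2 μ) atTop (𝓝 0)) :
    Tendsto (fun k => eLpNorm (fun x => a k x - c x) 2 μ) atTop (𝓝 0) := by
  have t1 : Tendsto (fun k : ℕ => ENNReal.ofReal ((k : ℝ) + 1)⁻¹) atTop (𝓝 0) := by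
    simpa using ENNReal.tendsto_ofReal tendsto_inv_add_one
  have t2 := t1.add h2
  rw [add_zero] at t2
  refine tendsto_of_tendsto_of_tendsto_of_le_of_le tendsto_const_nhds t2 (fun _ => zero_le)
    fun k => ?_
  have e : (fun x => a k x - c x) = (fun x => a k x - b k x) + fun x => b k x - c x := by
    ext1 x; simp
  simp only
  rw [e]
  refine (eLpNorm_add_le ((ha k).sub (hb k)) ((hb k).sub hc) (by simp)).trans ?_
  exact add_le_add (h1 k) le_rfl

/-- The limit in `H¹` of smooth functions on the half-space. -/
theorem exists_H1_of_tendsto {u : ℕ → Bd d × ℝ → ℂ} (hu : ∀ k, ContDiff ℝ ∞ (u k))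
    (h0 : ∀ k, MemLp (u k) 2 (vol d)) (h1 : ∀ k i, MemLp (pderiv i (u k)) 2 (vol d))
    (h2 : ∀ k, MemLp (fun x => u k (x, 0)) 2 volume) {V : Lp ℂ 2 (vol d)}
    {D : Fin d ⊕ Unit → Lp ℂ 2 (vol d)} {g : Lp ℂ 2 (volume : Measure (Bd d))}
    (hV : Tendsto (fun k => eLpNorm (fun p => u k p - V p) 2 (vol d)) atTop (𝓝 0))
    (hD : ∀ i, Tendsto (fun k => eLpNorm (fun p => pderiv i (u k) p - D i p) 2 (vol d))
      atTop (𝓝 0))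
    (hg : Tendsto (fun k => eLpNorm (fun x => u k (x, 0) - g x) 2 volume) atTop (𝓝 0)) :
    ∃ v : H1 d, v.val = V ∧ v.grad = D ∧ v.HasTrace g := by
  refine ⟨⟨V, D, fun i θ hθ hθc hθs => ?_⟩, rfl, rfl, ?_⟩
  · have t1 := tendsto_integral_mul h0 hV
      ((contDiff_pderiv hθ i).continuous.memLp_of_hasCompactSupport
      (hasCompactSupport_pderiv hθc i))
    have t2 := (tendsto_integral_mul (fun k => h1 k i) (hD i)
      (hθ.continuous.memLp_of_hasCompactSupport hθc)).neg
    refine tendsto_nhds_unique t1 (t2.congr fun k => ?_)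
    exact (integral_mul_pderiv (hu k) hθ hθc hθs i).symm
  -- The functions `u k` need not have compact support. Each is replaced by a truncation within
  -- `1/(k+1)` in all the norms that define the trace.
  · have key : ∀ k, ∃ φ : Bd d × ℝ → ℂ, (ContDiff ℝ ∞ φ ∧ HasCompactSupport φ) ∧
        eLpNorm (fun p => φ p - u k p) 2 (vol d) ≤ ENNReal.ofReal ((k : ℝ) + 1)⁻¹ ∧
        (∀ i, eLpNorm (fun p => pderiv i φ p - pderiv i (u k) p) 2 (vol d) ≤
          ENNReal.ofReal ((k : ℝ) + 1)⁻¹) ∧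
        eLpNorm (fun x => φ (x, 0) - u k (x, 0)) 2 volume ≤ ENNReal.ofReal ((k : ℝ) + 1)⁻¹ := by
      intro k
      obtain ⟨φ, hφ, a0, a1, a2⟩ :=
        exists_seq_hasCompactSupport_tendsto (hu k) (h0 k) (h1 k) (h2 k)
      have hpos : 0 < ENNReal.ofReal ((k : ℝ) + 1)⁻¹ := ENNReal.ofReal_pos.2 (by positivity)
      obtain ⟨j, b0, b1, b2⟩ := ((a0.eventually_le_const hpos).and
        ((eventually_all.2 fun i => (a1 i).eventually_le_const hpos).and
          (a2.eventually_le_const hpos))).exists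
      exact ⟨φ j, hφ j, b0, b1, b2⟩
    choose φ hφ b0 b1 b2 using key
    refine ⟨φ, hφ, ?_, fun i => ?_, ?_⟩
    · exact tendsto_eLpNorm_trans (fun k => (hφ k).1.continuous.aestronglyMeasurable)
        (fun k => (h0 k).1) (Lp.memLp V).1 b0 hV
    · exact tendsto_eLpNorm_trans
        (fun k => (contDiff_pderiv (hφ k).1 i).continuous.aestronglyMeasurable)
        (fun k => (h1 k i).1) (Lp.memLp (D i)).1 (fun k => b1 k i) (hD i)
    · exact tendsto_eLpNorm_trans
        (fun k => (contDiff_slice (hφ k).1 0).continuous.aestronglyMeasurable)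
        (fun k => (h2 k).1) (Lp.memLp g).1 b2 hg

/-- The minimizer: an extension whose energy equals the spectral form. -/
theorem exists_H1_wnorm_sq_eq (hσ : 0 < σ) {g : Lp ℂ 2 (volume : Measure (Bd d))}
    (hg : spectralSq σ g ≠ ⊤) :
    ∃ v : H1 d, v.HasTrace g ∧ ENNReal.ofReal (v.wnorm σ) ^ 2 = spectralSq σ g := by
  obtain ⟨ψ, Ψ, hψ, hc, ht, hΨ, htr⟩ := exists_seq_whiten hσ hg
  have hw := fun k => contDiff_whiten hσ (hψ k)
  have hwc := fun k => hasCompactSupport_whiten (σ := σ) (hc k)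
  have hm : ∀ k, MemLp (ψ k) 2 volume := fun k =>
    (hψ k).continuous.memLp_of_hasCompactSupport (hc k)
  set u : ℕ → Bd d × ℝ → ℂ := fun k => expExt σ (whiten σ (ψ k)) with hu_def
  have hu : ∀ k, ContDiff ℝ ∞ (u k) := fun k => contDiff_expExt hσ (hw k) (hwc k)
  have h0 : ∀ k, MemLp (u k) 2 (vol d) := fun k => memLp_expExt hσ (hw k) (hwc k)
  have h1 : ∀ k i, MemLp (pderiv i (u k)) 2 (vol d) := fun k i =>
    memLp_pderiv_expExt hσ (hw k) (hwc k) i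
  have hsub : ∀ k l, u k - u l = expExt σ (whiten σ (ψ k - ψ l)) := fun k l => by
    rw [whiten_sub, expExt_sub (hw k) (hwc k) (hw l) (hwc l)]
  have hP : Tendsto (fun k => (hm k).toLp (ψ k)) atTop (𝓝 Ψ) := by
    have := (Lp.tendsto_Lp_iff_tendsto_eLpNorm'' ψ hm Ψ (Lp.memLp Ψ)).2 ht
    rwa [Lp.toLp_coeFn] at this
  have hPe : ∀ k l, ‖(hm k).toLp (ψ k) - (hm l).toLp (ψ l)‖ₑ = eLpNorm (ψ k - ψ l) 2 volume := by
    intro k l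
    rw [← MemLp.toLp_sub, Lp.enorm_toLp]
  obtain ⟨V, hV⟩ := exists_tendsto_eLpNorm h0 hP.cauchySeq (ENNReal.ofReal σ⁻¹)
    ENNReal.ofReal_ne_top fun k l => by
      rw [hPe, hsub]
      exact eLpNorm_expExt_whiten_le hσ ((hψ k).sub (hψ l)) ((hc k).sub (hc l))
  have hD' : ∀ i, ∃ D : Lp ℂ 2 (vol d),
      Tendsto (fun k => eLpNorm (fun p => pderiv i (u k) p - D p) 2 (vol d)) atTop (𝓝 0) :=
    fun i => exists_tendsto_eLpNorm (fun k => h1 k i) hP.cauchySeq 1 ENNReal.one_ne_top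
      fun k l => by
        rw [hPe, ← pderiv_sub (hu k) (hu l), hsub, one_mul]
        exact eLpNorm_pderiv_expExt_whiten_le hσ ((hψ k).sub (hψ l)) ((hc k).sub (hc l)) i
  choose D hD using hD'
  have hz : ∀ k, (fun x => u k (x, 0)) = 𝓕⁻ (whiten σ (ψ k)) := fun k => by
    ext1 x; exact expExt_zero x
  have h2 : ∀ k, MemLp (fun x => u k (x, 0)) 2 volume := fun k => by
    refine ⟨(contDiff_slice (hu k) 0).continuous.aestronglyMeasurable, ?_⟩
    have h3 : eLpNorm (fun x => u k (x, 0)) 2 volume ^ 2 < ⊤ := by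
      rw [hz, eLpNorm_two_sq, lintegral_enorm_sq_fourierInv (hw k) (hwc k), ← eLpNorm_two_sq]
      exact ENNReal.pow_lt_top ((hw k).continuous.memLp_of_hasCompactSupport (hwc k)).2
    exact (ENNReal.pow_lt_top_iff.1 h3).resolve_right (by norm_num)
  obtain ⟨v, hvV, hvD, hv⟩ := exists_H1_of_tendsto hu h0 h1 h2 hV hD
    (g := g) (by simpa only [hu_def, expExt_zero] using htr)
  refine ⟨v, hv, ?_⟩
  rw [ofReal_wnorm_sq, hvV, hvD, ← hΨ]
  have t1 : Tendsto (fun k => energy σ (u k)) atTop (𝓝 (∑ i, ENNReal.ofReal (‖D i‖ ^ 2) +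
      ENNReal.ofReal (σ ^ 2) * ENNReal.ofReal (‖V‖ ^ 2))) :=
    Tendsto.add (tendsto_finsetSum _ fun i _ =>
      tendsto_lintegral_enorm_sq (fun k => h1 k i) (hD i))
      (ENNReal.Tendsto.const_mul (tendsto_lintegral_enorm_sq h0 hV)
        (Or.inr ENNReal.ofReal_ne_top))
  -- The energies of `u k` tend to the energy of `v`, and they equal the squared norms of `ψ k`,
  -- which tend to that of `Ψ`.
  refine tendsto_nhds_unique t1 ((tendsto_lintegral_enorm_sq hm ht).congr fun k => ?_)
  rw [hu_def, energy_expExt_whiten hσ (hψ k) (hc k)]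

/-- The constructed extension attains the spectral value, and no competitor falls below it. -/
theorem minExtNorm_sq_eq (hσ : 0 < σ) {g : Lp ℂ 2 (volume : Measure (Bd d))}
    (hg : spectralSq σ g ≠ ⊤) : minExtNorm σ g ^ 2 = spectralSq σ g := by
  obtain ⟨v, hv, he⟩ := exists_H1_wnorm_sq_eq hσ hg
  have hmono := ENNReal.pow_right_strictMono (n := 2) two_ne_zero
  rw [← he]
  congr 1
  refine le_antisymm (iInf₂_le v hv) (le_iInf₂ fun w hw => ?_)
  refine hmono.le_iff_le.1 ?_
  rw [he]
  exact spectralSq_le_wnorm_sq hw σ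

end HalfSpace

/-! ### The Gagliardo seminorm as a Fourier multiplier. -/

namespace HalfSpace

variable {d : ℕ}

/-- The Fourier multiplier of the difference `g(· + z) - g`. -/
def diffSymbol (z η : Bd d) : ℂ :=
  Complex.exp (((2 * Real.pi * inner ℝ z η : ℝ) : ℂ) * Complex.I) - 1

theorem continuous_diffSymbol :
    Continuous fun q : Bd d × Bd d => diffSymbol q.1 q.2 := by
  unfold diffSymbol; fun_prop

theorem norm_diffSymbol_le_two (z η : Bd d) : ‖diffSymbol z η‖ ≤ 2 := by
  refine (norm_sub_le _ _).trans ?_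
  rw [Complex.norm_exp_ofReal_mul_I, norm_one]; norm_num

theorem norm_diffSymbol_le (z η : Bd d) : ‖diffSymbol z η‖ ≤ 2 * Real.pi * ‖z‖ * ‖η‖ := by
  have h := Real.norm_exp_I_mul_ofReal_sub_one_le (x := 2 * Real.pi * inner ℝ z η)
  rw [mul_comm Complex.I] at h
  refine h.trans ?_
  rw [norm_mul, Real.norm_of_nonneg (by positivity), mul_assoc (2 * Real.pi)]
  gcongr
  exact abs_real_inner_le_norm z η

theorem fourier_diff {f : Bd d → ℂ} (hf : ContDiff ℝ ∞ f) (hc : HasCompactSupport f)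
    (z η : Bd d) : 𝓕 (fun x => f (x + z) - f x) η = diffSymbol z η * 𝓕 f η := by
  have hi : Integrable f := hf.continuous.integrable_of_hasCompactSupport hc
  have h1 : 𝓕 (fun x => f (x + z)) η =
      Complex.exp (((2 * Real.pi * inner ℝ z η : ℝ) : ℂ) * Complex.I) * 𝓕 f η := by
    have := congr_fun (VectorFourier.fourierIntegral_comp_add_right Real.fourierChar
      (volume : Measure (Bd d)) (innerₗ (Bd d)) f z) η
    simp only [Function.comp_def, innerₗ_apply_apply, Circle.smul_def, Real.fourierChar_apply,
      smul_eq_mul] at this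
    simpa [Real.fourier_eq, VectorFourier.fourierIntegral] using this
  have h2 : 𝓕 (fun x => f (x + z) - f x) η = 𝓕 (fun x => f (x + z)) η - 𝓕 f η := by
    simp only [Real.fourier_eq, smul_sub]
    exact integral_sub ((Real.fourierIntegral_convergent_iff _).2 (hi.comp_add_right z))
      ((Real.fourierIntegral_convergent_iff _).2 hi)
  rw [h2, h1, diffSymbol]; ring

theorem lintegral_enorm_sq_diff_smooth {f : Bd d → ℂ} (hf : ContDiff ℝ ∞ f)
    (hc : HasCompactSupport f) (z : Bd d) :
    ∫⁻ x, ‖f (x + z) - f x‖ₑ ^ 2 = ∫⁻ η, ‖diffSymbol z η * 𝓕 f η‖ₑ ^ 2 := by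
  have hz : ContDiff ℝ ∞ fun x => f (x + z) := hf.comp (contDiff_id.add contDiff_const)
  have hcz : HasCompactSupport fun x => f (x + z) :=
    hc.comp_homeomorph (Homeomorph.addRight z)
  rw [← lintegral_enorm_sq_fourier (hz.sub hf) (hcz.sub hc)]
  simp_rw [fourier_diff hf hc]

theorem eLpNorm_comp_add_right {u : Bd d → ℂ} (hu : AEStronglyMeasurable u volume) (z : Bd d) :
    eLpNorm (fun x => u (x + z)) 2 volume = eLpNorm u 2 volume :=
  eLpNorm_comp_measurePreserving (g := u) (f := fun x => x + z) hu
    (measurePreserving_add_right volume z)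

theorem memLp_comp_add_right {u : Bd d → ℂ} (hu : MemLp u 2 volume) (z : Bd d) :
    MemLp (fun x => u (x + z)) 2 volume :=
  hu.comp_measurePreserving (f := fun x => x + z) (measurePreserving_add_right volume z)

theorem eLpNorm_diff_le {u : Bd d → ℂ} (hu : MemLp u 2 volume) (z : Bd d) :
    eLpNorm (fun x => u (x + z) - u x) 2 volume ≤ eLpNorm u 2 volume + eLpNorm u 2 volume := by
  have h := eLpNorm_sub_le (p := 2) (memLp_comp_add_right hu z).1 hu.1 (by simp)
  rwa [eLpNorm_comp_add_right hu.1] at h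

theorem tendsto_lintegral_diff {f : ℕ → Bd d → ℂ} {g : Lp ℂ 2 (volume : Measure (Bd d))}
    (hf : ∀ k, MemLp (f k) 2 volume)
    (h : Tendsto (fun k => eLpNorm (fun x => f k x - g x) 2 volume) atTop (𝓝 0)) (z : Bd d) :
    Tendsto (fun k => ∫⁻ x, ‖f k (x + z) - f k x‖ₑ ^ 2) atTop
      (𝓝 (∫⁻ x, ‖g (x + z) - g x‖ₑ ^ 2)) := by
  have hL : MemLp (fun x => g (x + z) - g x) 2 volume :=
    (memLp_comp_add_right (Lp.memLp g) z).sub (Lp.memLp g)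
  have hLk : ∀ k, MemLp (fun x => f k (x + z) - f k x) 2 volume := fun k =>
    (memLp_comp_add_right (hf k) z).sub (hf k)
  rw [← lintegral_enorm_sq_congr hL.coeFn_toLp, lintegral_enorm_sq_lp]
  refine tendsto_lintegral_enorm_sq hLk ?_
  have h2 : Tendsto (fun k => eLpNorm (fun x => f k x - g x) 2 volume +
      eLpNorm (fun x => f k x - g x) 2 volume) atTop (𝓝 0) := by simpa using h.add h
  refine tendsto_of_tendsto_of_tendsto_of_le_of_le tendsto_const_nhds h2 (fun _ => zero_le)
    fun k => ?_
  have h3 : MemLp (fun x => f k x - g x) 2 volume := (hf k).sub (Lp.memLp g)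
  have h4 := eLpNorm_diff_le h3 z
  have h5 : (fun x => f k (x + z) - f k x - hL.toLp _ x) =ᵐ[volume]
      fun x => f k (x + z) - g (x + z) - (f k x - g x) := by
    filter_upwards [hL.coeFn_toLp] with x hx
    rw [hx]; ring
  rw [eLpNorm_congr_ae h5]
  exact h4

theorem memLp_diffSymbol_mul {u : Bd d → ℂ} (hu : MemLp u 2 volume) (z : Bd d) :
    MemLp (fun η => diffSymbol z η * u η) 2 volume := by
  have hsymb : Continuous fun η : Bd d => diffSymbol z η :=
    by unfold diffSymbol; fun_prop
  refine hu.of_le_mul (c := 2) (hsymb.aestronglyMeasurable.mul hu.1) (Eventually.of_forall ?_)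
  intro η
  rw [norm_mul]; gcongr; exact norm_diffSymbol_le_two z η

theorem tendsto_lintegral_diffSymbol_mul {u : ℕ → Bd d → ℂ}
    {v : Lp ℂ 2 (volume : Measure (Bd d))} (hu : ∀ k, MemLp (u k) 2 volume)
    (h : Tendsto (fun k => eLpNorm (fun x => u k x - v x) 2 volume) atTop (𝓝 0)) (z : Bd d) :
    Tendsto (fun k => ∫⁻ η, ‖diffSymbol z η * u k η‖ₑ ^ 2) atTop
      (𝓝 (∫⁻ η, ‖diffSymbol z η * v η‖ₑ ^ 2)) := by
  have hR := memLp_diffSymbol_mul (Lp.memLp v) z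
  rw [← lintegral_enorm_sq_congr hR.coeFn_toLp, lintegral_enorm_sq_lp]
  refine tendsto_lintegral_enorm_sq (fun k => memLp_diffSymbol_mul (hu k) z) ?_
  have h2 := ENNReal.Tendsto.const_mul h (a := ENNReal.ofReal 2) (Or.inr ENNReal.ofReal_ne_top)
  rw [mul_zero] at h2
  refine tendsto_of_tendsto_of_tendsto_of_le_of_le tendsto_const_nhds h2 (fun _ => zero_le)
    fun k => ?_
  refine eLpNorm_le_mul_eLpNorm_of_ae_le_mul ?_ 2
  filter_upwards [hR.coeFn_toLp] with η hη
  rw [hη, ← mul_sub, norm_mul]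
  gcongr
  exact norm_diffSymbol_le_two z η

/-- Plancherel holds for differences of test functions, and both sides are continuous in `L²`
because the symbol is bounded by `2`. -/
theorem lintegral_enorm_sq_diff (g : Lp ℂ 2 (volume : Measure (Bd d))) (z : Bd d) :
    ∫⁻ x, ‖g (x + z) - g x‖ₑ ^ 2 =
      ∫⁻ η, ‖diffSymbol z η * (𝓕 g : Lp ℂ 2 (volume : Measure (Bd d))) η‖ₑ ^ 2 := by
  obtain ⟨f, hf, hc, h⟩ := exists_seq_contDiff_tendsto g
  have t1 := tendsto_lintegral_diff (fun k =>
    (hf k).continuous.memLp_of_hasCompactSupport (hc k)) h z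
  simp_rw [lintegral_enorm_sq_diff_smooth (hf _) (hc _) z] at t1
  exact tendsto_nhds_unique t1 (tendsto_lintegral_diffSymbol_mul
    (fun k => memLp_fourier (hf k) (hc k)) (tendsto_eLpNorm_fourier_sub hf hc h) z)

/-- The symbol of the Gagliardo seminorm. -/
def gagliardoSymbol (η : Bd d) : ℝ≥0∞ :=
  ∫⁻ z : Bd d, ‖diffSymbol z η‖ₑ ^ 2 / ‖z‖ₑ ^ (d + 1)

/-- Substitute `y = x + z`, apply Plancherel in `x` for each fixed `z`, and exchange the integrals
by Tonelli. -/
theorem gagliardoSq_eq (g : Lp ℂ 2 (volume : Measure (Bd d))) :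
    gagliardoSq g =
      ∫⁻ η, gagliardoSymbol η * ‖(𝓕 g : Lp ℂ 2 (volume : Measure (Bd d))) η‖ₑ ^ 2 := by
  have hg : Measurable g := (Lp.stronglyMeasurable g).measurable
  have hF : Measurable (𝓕 g : Lp ℂ 2 (volume : Measure (Bd d))) :=
    (Lp.stronglyMeasurable _).measurable
  have hs : Measurable fun q : Bd d × Bd d => ‖diffSymbol q.1 q.2‖ₑ ^ 2 / ‖q.1‖ₑ ^ (d + 1) :=
    (continuous_diffSymbol.measurable.enorm.pow_const 2).div (measurable_fst.enorm.pow_const _)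
  calc gagliardoSq g
      = ∫⁻ x : Bd d, ∫⁻ z : Bd d, ‖g (x + z) - g x‖ₑ ^ 2 / ‖z‖ₑ ^ (d + 1) := by
        refine lintegral_congr fun x => ?_
        rw [← lintegral_add_left_eq_self _ x]
        refine lintegral_congr fun z => ?_
        rw [sub_add_cancel_left, enorm_neg, ← enorm_neg (g x - _), neg_sub]
    _ = ∫⁻ z : Bd d, ∫⁻ x : Bd d, ‖g (x + z) - g x‖ₑ ^ 2 / ‖z‖ₑ ^ (d + 1) := by
        refine lintegral_lintegral_swap (Measurable.aemeasurable ?_)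
        exact ((((hg.comp (measurable_fst.add measurable_snd)).sub
          (hg.comp measurable_fst)).enorm.pow_const 2)).div (measurable_snd.enorm.pow_const _)
    _ = ∫⁻ z : Bd d, ∫⁻ η : Bd d, ‖diffSymbol z η‖ₑ ^ 2 / ‖z‖ₑ ^ (d + 1) *
          ‖(𝓕 g : Lp ℂ 2 (volume : Measure (Bd d))) η‖ₑ ^ 2 := by
        refine lintegral_congr fun z => ?_
        have hz : Measurable fun η => diffSymbol z η :=
          (by unfold diffSymbol; fun_prop : Continuous fun η => diffSymbol z η).measurable
        simp_rw [div_eq_mul_inv]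
        rw [lintegral_mul_const _ (by fun_prop), lintegral_enorm_sq_diff,
          ← lintegral_mul_const _ (by fun_prop)]
        refine lintegral_congr fun η => ?_
        rw [enorm_mul, mul_pow]; ring
    _ = _ := by
        rw [lintegral_lintegral_swap]
        · refine lintegral_congr fun η => ?_
          have := hs.comp (measurable_id.prodMk (measurable_const (a := η)))
          exact lintegral_mul_const _ this
        · exact (hs.mul ((hF.comp measurable_snd).enorm.pow_const 2)).aemeasurable

end HalfSpace

/-! ### Evaluation of the symbol, normalization and norm equivalence. -/

namespace HalfSpace

variable {d : ℕ}

theorem lintegral_comp_smul {F : Bd d → ℝ≥0∞} (hF : Measurable F) {r : ℝ} (hr : 0 < r) :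
    ∫⁻ x, F (r • x) = ENNReal.ofReal ((r ^ d)⁻¹) * ∫⁻ x, F x := by
  rw [← lintegral_map hF (measurable_const_smul r),
    Measure.map_addHaar_smul volume hr.ne', lintegral_smul_measure]
  simp [abs_of_pos hr]

theorem measurable_gagliardoSymbol_integrand (η : Bd d) :
    Measurable fun z : Bd d => ‖diffSymbol z η‖ₑ ^ 2 / ‖z‖ₑ ^ (d + 1) :=
  (((by unfold diffSymbol; fun_prop : Continuous fun z => diffSymbol z η).measurable
    ).enorm.pow_const 2).div (measurable_id.enorm.pow_const _)

theorem gagliardoSymbol_isometry (R : Bd d ≃ₗᵢ[ℝ] Bd d) (η : Bd d) :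
    gagliardoSymbol (R η) = gagliardoSymbol η := by
  rw [gagliardoSymbol, ← R.measurePreserving.lintegral_comp
    (measurable_gagliardoSymbol_integrand _), gagliardoSymbol]
  simp [diffSymbol, ← ofReal_norm]

/-- In the substitution `z ↦ r z` the kernel contributes `r^(d+1)` and the measure `r^(-d)`. -/
theorem gagliardoSymbol_smul {r : ℝ} (hr : 0 < r) (η : Bd d) :
    gagliardoSymbol (r • η) = ENNReal.ofReal r * gagliardoSymbol η := by
  have h0 : ENNReal.ofReal r ≠ 0 := by simpa using hr
  have h : ∀ z : Bd d, ‖diffSymbol z (r • η)‖ₑ ^ 2 / ‖z‖ₑ ^ (d + 1) =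
      ENNReal.ofReal (r ^ (d + 1)) * (‖diffSymbol (r • z) η‖ₑ ^ 2 / ‖r • z‖ₑ ^ (d + 1)) := by
    intro z
    have e : diffSymbol z (r • η) = diffSymbol (r • z) η := by
      simp [diffSymbol, inner_smul_left, inner_smul_right]
    rw [e, enorm_smul, Real.enorm_of_nonneg hr.le, mul_pow, ENNReal.ofReal_pow hr.le,
      ← mul_div_assoc, ENNReal.mul_div_mul_left _ _ (pow_ne_zero _ h0)
        (ENNReal.pow_ne_top ENNReal.ofReal_ne_top)]
  rw [gagliardoSymbol, lintegral_congr h, lintegral_const_mul' _ _ ENNReal.ofReal_ne_top,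
    lintegral_comp_smul (measurable_gagliardoSymbol_integrand η) hr, ← mul_assoc,
    ← ENNReal.ofReal_mul (by positivity), gagliardoSymbol]
  congr 2
  rw [pow_succ, mul_comm _ r, mul_assoc, mul_inv_cancel₀ (by positivity), mul_one]

theorem gagliardoSymbol_eq {e : Bd d} (he : ‖e‖ = 1) (η : Bd d) :
    gagliardoSymbol η = ENNReal.ofReal ‖η‖ * gagliardoSymbol e := by
  rcases eq_or_ne η 0 with rfl | hη
  · simp [gagliardoSymbol, diffSymbol]
  have hn : 0 < ‖η‖ := norm_pos_iff.2 hη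
  set u := ‖η‖⁻¹ • η with hu
  have hu1 : ‖e‖ = ‖u‖ := by
    rw [he, hu, norm_smul, norm_inv, norm_norm, inv_mul_cancel₀ hn.ne']
  -- The reflection in the hyperplane orthogonal to `e - u` carries `e` to `u = η/‖η‖`.
  have h := gagliardoSymbol_isometry ((ℝ ∙ (e - u))ᗮ.reflection) e
  rw [Submodule.reflection_sub hu1] at h
  rw [← h, ← gagliardoSymbol_smul hn, hu, smul_smul, mul_inv_cancel₀ hn.ne', one_smul]

theorem gagliardoSymbol_lt_top (hd : d ≠ 0) {e : Bd d} (he : ‖e‖ = 1) :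
    gagliardoSymbol e < ⊤ := by
  have : Nontrivial (Bd d) := ⟨e, 0, fun h => by simp [h] at he⟩
  -- The bounds `4` and `4π²|z|²` on the squared symbol combine into `(4 + 4π²)|z|²/(1 + |z|²)`. In
  -- polar coordinates the powers of the radius cancel, leaving a multiple of `1/(1 + y²)`.
  set H : ℝ → ℝ := fun y => (4 + 4 * Real.pi ^ 2) * (y ^ 2 * (1 + y ^ 2)⁻¹ * (y ^ (d + 1))⁻¹)
  have hH : Integrable (fun z : Bd d => H ‖z‖) := by
    rw [integrable_fun_norm_addHaar (volume : Measure (Bd d))]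
    have h1 : IntegrableOn (fun y : ℝ => (4 + 4 * Real.pi ^ 2) * (1 + y ^ 2)⁻¹) (Set.Ioi 0) :=
      (integrable_inv_one_add_sq.const_mul _).integrableOn
    refine h1.congr_fun (fun y hy => ?_) measurableSet_Ioi
    have hy0 : (0 : ℝ) < y := hy
    obtain ⟨m, rfl⟩ := Nat.exists_eq_succ_of_ne_zero hd
    simp only [finrank_euclideanSpace, Fintype.card_fin, smul_eq_mul, H, Nat.succ_sub_one,
      Nat.succ_eq_add_one]
    field_simp
    ring
  refine lt_of_le_of_lt (lintegral_mono fun z => ?_) hH.lintegral_lt_top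
  -- At the origin the integrand is `0 / 0`, which is `0` in `ℝ≥0∞`.
  rcases eq_or_ne z 0 with rfl | hz
  · simp [diffSymbol]
  have hn : 0 < ‖z‖ := norm_pos_iff.2 hz
  rw [← ofReal_norm, ← ofReal_norm, ← ENNReal.ofReal_pow (norm_nonneg _),
    ← ENNReal.ofReal_pow (norm_nonneg _), ← ENNReal.ofReal_div_of_pos (by positivity)]
  refine ENNReal.ofReal_le_ofReal ?_
  have h1 := norm_diffSymbol_le_two z e
  have h2 := norm_diffSymbol_le z e
  rw [he, mul_one] at h2
  have h1' := pow_le_pow_left₀ (norm_nonneg _) h1 2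
  have h2' := pow_le_pow_left₀ (norm_nonneg _) h2 2
  have h3 : ‖diffSymbol z e‖ ^ 2 ≤ (4 + 4 * Real.pi ^ 2) * (‖z‖ ^ 2 * (1 + ‖z‖ ^ 2)⁻¹) := by
    rw [← mul_assoc, ← div_eq_mul_inv, le_div_iff₀ (by positivity)]
    nlinarith [mul_le_mul_of_nonneg_right h1' (sq_nonneg ‖z‖)]
  calc ‖diffSymbol z e‖ ^ 2 / ‖z‖ ^ (d + 1)
      ≤ (4 + 4 * Real.pi ^ 2) * (‖z‖ ^ 2 * (1 + ‖z‖ ^ 2)⁻¹) / ‖z‖ ^ (d + 1) := by gcongr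
    _ = H ‖z‖ := by simp only [H]; ring

theorem gagliardoSymbol_pos {e : Bd d} (he : ‖e‖ = 1) : 0 < gagliardoSymbol e := by
  rw [pos_iff_ne_zero]
  intro h
  rw [gagliardoSymbol, lintegral_eq_zero_iff (measurable_gagliardoSymbol_integrand e)] at h
  have hc : Continuous fun z => diffSymbol z e := by unfold diffSymbol; fun_prop
  have ho : IsOpen {z | diffSymbol z e ≠ 0} := isOpen_ne_fun hc continuous_const
  -- At `z = e/2` the symbol is `exp (iπ) - 1 = -2`, so the integrand is nonzero on a nonempty open
  -- set.
  have hne : ((2 : ℝ)⁻¹ • e) ∈ {z | diffSymbol z e ≠ 0} := by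
    have h1 : (((2 * Real.pi * inner ℝ ((2 : ℝ)⁻¹ • e) e : ℝ) : ℂ)) = Real.pi := by
      rw [inner_smul_left, real_inner_self_eq_norm_sq, he]
      norm_num
      ring
    simp only [Set.mem_ofPred_eq, diffSymbol, h1, Complex.exp_pi_mul_I]
    norm_num
  refine (ho.measure_pos volume ⟨_, hne⟩).ne' (measure_mono_null (fun z hz => ?_) h)
  simp only [Set.mem_compl_iff, Set.mem_ofPred_eq, Pi.zero_apply]
  exact (ENNReal.div_pos (by simpa using hz) (ENNReal.pow_ne_top enorm_ne_top)).ne'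

theorem exists_gagliardoSq_eq (hd : d ≠ 0) : ∃ κ : ℝ, 0 < κ ∧
    ∀ g : Lp ℂ 2 (volume : Measure (Bd d)), gagliardoSq g = ENNReal.ofReal κ *
      ∫⁻ η, ENNReal.ofReal ‖η‖ * ‖(𝓕 g : Lp ℂ 2 (volume : Measure (Bd d))) η‖ₑ ^ 2 := by
  have he : ‖(EuclideanSpace.single ⟨0, Nat.pos_of_ne_zero hd⟩ 1 : Bd d)‖ = 1 := by simp
  have hlt := gagliardoSymbol_lt_top hd he
  refine ⟨_, ENNReal.toReal_pos (gagliardoSymbol_pos he).ne' hlt.ne, fun g => ?_⟩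
  rw [gagliardoSq_eq, ENNReal.ofReal_toReal hlt.ne, ← lintegral_const_mul' _ _ hlt.ne]
  refine lintegral_congr fun η => ?_
  rw [gagliardoSymbol_eq he]; ring

/-- Under `ξ = 2πη` the constants cancel: `(2π)^d` from the formula, `(2π)^(-2d)` from the squared
normalization and `(2π)^d` from the Jacobian. -/
theorem lintegral_fourierT_eq_spectralSq (σ : ℝ) (g : Lp ℂ 2 (volume : Measure (Bd d))) :
    ENNReal.ofReal ((2 * Real.pi) ^ d) * ∫⁻ ξ : Bd d, ENNReal.ofReal
      ((σ ^ 2 + ‖ξ‖ ^ 2) ^ (1 / 2 : ℝ) * ‖fourierT g ξ‖ ^ 2) = spectralSq σ g := by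
  have hpi : 0 < 2 * Real.pi := by positivity
  have hF : Measurable (𝓕 g : Lp ℂ 2 (volume : Measure (Bd d))) :=
    (Lp.stronglyMeasurable _).measurable
  have h := lintegral_comp_smul (F := fun η => ENNReal.ofReal (lam σ η) *
    ‖(𝓕 g : Lp ℂ 2 (volume : Measure (Bd d))) η‖ₑ ^ 2)
    ((continuous_lam σ).measurable.ennreal_ofReal.mul (hF.enorm.pow_const 2)) (inv_pos.2 hpi)
  have e : ∀ ξ : Bd d, ENNReal.ofReal ((σ ^ 2 + ‖ξ‖ ^ 2) ^ (1 / 2 : ℝ) * ‖fourierT g ξ‖ ^ 2) =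
      ENNReal.ofReal ((((2 * Real.pi) ^ d)⁻¹) ^ 2) *
        (ENNReal.ofReal (lam σ ((2 * Real.pi)⁻¹ • ξ)) *
        ‖(𝓕 g : Lp ℂ 2 (volume : Measure (Bd d))) ((2 * Real.pi)⁻¹ • ξ)‖ₑ ^ 2) := by
    intro ξ
    have e1 : lam σ ((2 * Real.pi)⁻¹ • ξ) = (σ ^ 2 + ‖ξ‖ ^ 2) ^ (1 / 2 : ℝ) := by
      rw [lam, Real.sqrt_eq_rpow, norm_smul, norm_inv, Real.norm_of_nonneg hpi.le,
        mul_inv_cancel_left₀ hpi.ne']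
    rw [e1, fourierT, norm_mul, ← ofReal_norm, ← ENNReal.ofReal_pow (norm_nonneg _),
      ← ENNReal.ofReal_mul (by positivity), ← ENNReal.ofReal_mul (by positivity),
      Complex.norm_real, Real.norm_of_nonneg (by positivity)]
    congr 1; ring
  rw [lintegral_congr e, lintegral_const_mul' _ _ ENNReal.ofReal_ne_top, h, ← mul_assoc,
    ← mul_assoc, ← ENNReal.ofReal_mul (by positivity), ← ENNReal.ofReal_mul (by positivity)]
  have : (2 * Real.pi) ^ d * (((2 * Real.pi) ^ d)⁻¹) ^ 2 * (((2 * Real.pi)⁻¹ ^ d)⁻¹) = 1 := by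
    rw [inv_pow (2 * Real.pi), inv_inv]; field_simp
  rw [this, ENNReal.ofReal_one, one_mul, spectralSq]

/-- By Plancherel the middle quantity has density `κ|η| + σ`. The bounds follow from `max σ (2π|η|)
≤ λ ≤ σ + 2π|η|`; the factor `2` in the lower constant comes from adding two bounds by `λ`. -/
theorem spectralSq_bounds {κ : ℝ} (hκ : 0 < κ) {g : Lp ℂ 2 (volume : Measure (Bd d))}
    (hg : gagliardoSq g = ENNReal.ofReal κ *
      ∫⁻ η, ENNReal.ofReal ‖η‖ * ‖(𝓕 g : Lp ℂ 2 (volume : Measure (Bd d))) η‖ₑ ^ 2)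
    {σ : ℝ} (hσ : 0 < σ) :
    ENNReal.ofReal (2 * max 1 (κ * (2 * Real.pi)⁻¹))⁻¹ *
        (gagliardoSq g + ENNReal.ofReal (σ * ‖g‖ ^ 2)) ≤ spectralSq σ g ∧
      spectralSq σ g ≤ ENNReal.ofReal (max 1 (2 * Real.pi * κ⁻¹)) *
        (gagliardoSq g + ENNReal.ofReal (σ * ‖g‖ ^ 2)) := by
  have hpi : 0 < 2 * Real.pi := by positivity
  have hF : Measurable (𝓕 g : Lp ℂ 2 (volume : Measure (Bd d))) :=
    (Lp.stronglyMeasurable _).measurable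
  have hsum : gagliardoSq g + ENNReal.ofReal (σ * ‖g‖ ^ 2) =
      ∫⁻ η, ENNReal.ofReal (κ * ‖η‖ + σ) *
        ‖(𝓕 g : Lp ℂ 2 (volume : Measure (Bd d))) η‖ₑ ^ 2 := by
    rw [hg, ENNReal.ofReal_mul hσ.le, ← lintegral_enorm_sq_lp, ← lintegral_enorm_sq_fourier_lp,
      ← lintegral_const_mul' _ _ ENNReal.ofReal_ne_top,
      ← lintegral_const_mul' _ _ ENNReal.ofReal_ne_top,
      ← lintegral_add_right _ ((hF.enorm.pow_const 2).const_mul _)]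
    refine lintegral_congr fun η => ?_
    rw [ENNReal.ofReal_add (by positivity) hσ.le, ENNReal.ofReal_mul hκ.le]
    ring
  rw [hsum, spectralSq, ← lintegral_const_mul' _ _ ENNReal.ofReal_ne_top,
    ← lintegral_const_mul' _ _ ENNReal.ofReal_ne_top]
  have key : ∀ {a b : ℝ} {η : Bd d}, a ≤ b →
      ENNReal.ofReal a * ‖(𝓕 g : Lp ℂ 2 (volume : Measure (Bd d))) η‖ₑ ^ 2 ≤
      ENNReal.ofReal b * ‖(𝓕 g : Lp ℂ 2 (volume : Measure (Bd d))) η‖ₑ ^ 2 := by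
    intro a b η h; gcongr
  constructor
  · refine lintegral_mono fun η => ?_
    rw [← mul_assoc, ← ENNReal.ofReal_mul (by positivity)]
    refine key ?_
    rw [inv_mul_le_iff₀ (by positivity)]
    have h1 : 2 * Real.pi * ‖η‖ ≤ lam σ η :=
      Real.le_sqrt_of_sq_le (by nlinarith [sq_nonneg σ])
    have h2 := le_lam (σ := σ) η
    have h3 : κ * ‖η‖ = κ * (2 * Real.pi)⁻¹ * (2 * Real.pi * ‖η‖) := by field_simp
    have h4 : κ * (2 * Real.pi)⁻¹ * (2 * Real.pi * ‖η‖) ≤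
        max 1 (κ * (2 * Real.pi)⁻¹) * lam σ η := by
      gcongr; exact le_max_right _ _
    have h5 : 1 * σ ≤ max 1 (κ * (2 * Real.pi)⁻¹) * lam σ η := by
      gcongr; exact le_max_left _ _
    linarith
  · refine lintegral_mono fun η => ?_
    rw [← mul_assoc, ← ENNReal.ofReal_mul (by positivity)]
    refine key ?_
    have h1 : lam σ η ≤ σ + 2 * Real.pi * ‖η‖ := by
      refine Real.sqrt_le_iff.2 ⟨by positivity, ?_⟩
      nlinarith [mul_nonneg hσ.le (mul_nonneg hpi.le (norm_nonneg η))]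
    have h3 : 2 * Real.pi * ‖η‖ = 2 * Real.pi * κ⁻¹ * (κ * ‖η‖) := by field_simp
    have h4 : 2 * Real.pi * κ⁻¹ * (κ * ‖η‖) ≤ max 1 (2 * Real.pi * κ⁻¹) * (κ * ‖η‖) := by
      gcongr; exact le_max_right _ _
    have h5 : 1 * σ ≤ max 1 (2 * Real.pi * κ⁻¹) * σ := by gcongr; exact le_max_left _ _
    linarith

end HalfSpace

end

theorem mainTheorem9 (n : ℕ) (hn : 2 ≤ n) :
    (∀ g : Lp ℂ 2 (volume : Measure (HalfSpace.Bd (n - 1))), HalfSpace.MemHHalf g →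
      ∀ σ : ℝ, 0 < σ →
        HalfSpace.minExtNorm σ g ^ 2 =
          ENNReal.ofReal ((2 * Real.pi) ^ (n - 1)) *
            ∫⁻ ξ : HalfSpace.Bd (n - 1),
              ENNReal.ofReal
                ((σ ^ 2 + ‖ξ‖ ^ 2) ^ (1 / 2 : ℝ) * ‖HalfSpace.fourierT g ξ‖ ^ 2)) ∧
    ∃ c C : ℝ, 0 < c ∧ 0 < C ∧
      ∀ g : Lp ℂ 2 (volume : Measure (HalfSpace.Bd (n - 1))), HalfSpace.MemHHalf g →
        ∀ σ : ℝ, 0 < σ →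
          ENNReal.ofReal c * (HalfSpace.gagliardoSq g + ENNReal.ofReal (σ * ‖g‖ ^ 2)) ≤
              HalfSpace.minExtNorm σ g ^ 2 ∧
            HalfSpace.minExtNorm σ g ^ 2 ≤
              ENNReal.ofReal C *
                (HalfSpace.gagliardoSq g + ENNReal.ofReal (σ * ‖g‖ ^ 2)) := by
  obtain ⟨κ, hκ, hgag⟩ := HalfSpace.exists_gagliardoSq_eq (d := n - 1) (by omega)
  -- The upper comparison makes the spectral form finite on `H^{1/2}`, as the existence of the
  -- minimizer requires.
  have hfin : ∀ g : Lp ℂ 2 (volume : Measure (HalfSpace.Bd (n - 1))), HalfSpace.MemHHalf g →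
      ∀ σ : ℝ, 0 < σ → HalfSpace.spectralSq σ g ≠ ⊤ := fun g hg σ hσ =>
    ne_top_of_le_ne_top (ENNReal.mul_ne_top ENNReal.ofReal_ne_top
      (ENNReal.add_ne_top.2 ⟨hg.ne, ENNReal.ofReal_ne_top⟩))
      (HalfSpace.spectralSq_bounds hκ (hgag g) hσ).2
  refine ⟨fun g hg σ hσ => ?_, (2 * max 1 (κ * (2 * Real.pi)⁻¹))⁻¹,
    max 1 (2 * Real.pi * κ⁻¹), by positivity, by positivity, fun g hg σ hσ => ?_⟩
  · rw [HalfSpace.lintegral_fourierT_eq_spectralSq,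
      HalfSpace.minExtNorm_sq_eq hσ (hfin g hg σ hσ)]
  · rw [HalfSpace.minExtNorm_sq_eq hσ (hfin g hg σ hσ)]
    exact HalfSpace.spectralSq_bounds hκ (hgag g) hσ
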